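/- Let $K$ be a field, let $k\ge 3$, and let $0=a_0<a_1<\dots<a_k=:d$ be integers with $\gcd(a_1,\dots,a_k)=1$. Put $\mathbf e_h=(h,d-h)$ for $0\le h\le d$, let $S\subseteq\mathbb N^2$ be the affine semigroup generated by $\mathbf e_{a_0},\dots,\mathbf e_{a_k}$, let $K[S]$ be its semigroup ring, and let $\mathfrak m$ be the ideal of $K[S]$ generated by the monomials with exponents in $S\setminus\{0\}$. Put $A_1=\{a_0,\dots,a_k\}$ and $A_2=\{d-a_k,\dots,d-a_0\}$. For $l=1,2$ let $\omega_l(i)$ be the least element of the numerical semigroup $\langle A_l\rangle$ that is congruent to $i$ modulo $d$, and for $n\in\mathbb N$ let $\delta_l(n)$ be the least number of summands in an expression of $n$ as a sum of elements of $A_l\setminus\{0\}$, repetitions allowed ($\infty$ if there is none). For $\mathbf u=(u_1,u_2)\in\mathbb N^2$ with $d\mid u_1+u_2$ write $\deg\mathbf u=(u_1+u_2)/d$ and $\delta_l(\mathbf u)=\delta_l(u_l)$. Let $\mathbf w_i=(\omega_1(i),\omega_2(d-i))$ for $0\le i\le d-1$, and $$\mathbb I=\{\,1\le i\le d-1 \mid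 i\notin\{a_1,\dots,a_{k-1}\},\ \delta_1(\mathbf w_i)>\deg(\mathbf w_i)\,\}.$$ Call $K[S]$ Buchsbaum if $\mathfrak m H^1_{\mathfrak m}(K[S])=0$. Consider the condition $$(*)\qquad \delta_1(\mathbf w_i)=\delta_2(\mathbf w_i)=\deg(\mathbf w_i)+1 .$$ (i) The ring $K[S]$ is Cohen–Macaulay if and only if $\mathbb I=\emptyset$. (ii) If $(*)$ holds for all $i\in\mathbb I$, then $H^1_{\mathfrak m}(K[S])\cong\bigoplus_{i\in\mathbb I}K\mathbf w_i$ as $K$-vector spaces, and $\ell(H^1_{\mathfrak m}(K[S]))=\sharp\,\mathbb I\le d-k$, where $\ell$ denotes the length as a $K[S]$-module and $K\mathbf w_i$ is the one-dimensional space spanned by the monomial with exponent $\mathbf w_i$. (iii) The ring $K[S]$ is Buchsbaum and not Cohen–Macaulay if and only if $\mathbb I\ne\emptyset$, condition $(*)$ holds for all $i\in\mathbb I$, and there are no $i,j\in\mathbb I$ with $\mathbf w_j-\mathbf w_i=\mathbf e_h$ for some $h\in\{a_1,\dots,a_{k-1}\}$. -/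

import Mathlib

open scoped DirectSum

universe u

noncomputable section

/-- A Noetherian local ring is Cohen-Macaulay if its maximal ideal contains a regular sequence
whose length is the Krull dimension of the ring. -/
def IsCohenMacaulayLocalRing (R : Type*) [CommRing R] [IsLocalRing R] : Prop :=
  IsNoetherianRing R ∧
    ∃ rs : List R, (∀ r ∈ rs, r ∈ IsLocalRing.maximalIdeal R) ∧
      RingTheory.Sequence.IsRegular R rs ∧ (rs.length : WithBot ℕ∞) = ringKrullDim R

/-- A commutative ring is Cohen-Macaulay if it is Noetherian and its localization at every
maximal ideal is a Cohen-Macaulay local ring. -/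
def IsCohenMacaulayRing (R : Type*) [CommRing R] : Prop :=
  IsNoetherianRing R ∧
    ∀ (n : Ideal R) [n.IsMaximal], IsCohenMacaulayLocalRing (Localization.AtPrime n)

namespace MonomialCurve

/-- `ω_A(i)`, the least element of the numerical semigroup generated by `A` that is congruent
to `i` modulo `d`; here `d` is the largest element of `A`. -/
def omega (A : Finset ℕ) (d i : ℕ) : ℕ :=
  sInf {n : ℕ | n ∈ AddSubmonoid.closure (A : Set ℕ) ∧ n ≡ i [MOD d]}

/-- `δ_A(n)`, the least number of summands in a presentation of `n` as a sum of elements of `A`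
(with repetitions); it is `⊤` if there is none. -/
def delta (A : Finset ℕ) (n : ℕ) : ℕ∞ :=
  ⨅ (x : ℕ → ℕ) (_ : ∑ α ∈ A, x α * α = n), ((∑ α ∈ A, x α : ℕ) : ℕ∞)

variable {k : ℕ} (a : Fin (k + 1) → ℕ)

/-- `d = a_k`. -/
def d : ℕ := a (Fin.last k)

/-- `A₁ = {a_0, a_1, …, a_k}`. -/
def A₁ : Finset ℕ := Finset.univ.image a

/-- `A₂ = {d - a_k, …, d - a_1, d - a_0}`. -/
def A₂ : Finset ℕ := Finset.univ.image fun j => d a - a j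

/-- `{a_1, …, a_{k-1}}`. -/
def inner : Finset ℕ := (Finset.Ioo 0 (Fin.last k)).image a

/-- `e_h = (h, d - h)`, for `0 ≤ h ≤ d`. -/
def e (h : ℕ) : ℕ × ℕ := (h, d a - h)

/-- The affine semigroup `S` generated by `e_{a_0}, …, e_{a_k}`. -/
def S : AddSubmonoid (ℕ × ℕ) := AddSubmonoid.closure (Set.range fun j => e a (a j))

/-- `deg u = (u₁ + u₂) / d`. It is only used for `u` with `d ∣ u₁ + u₂`,
where the division is exact. -/
def deg (u : ℕ × ℕ) : ℕ := (u.1 + u.2) / d a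

/-- `w_i = (ω₁(i), ω₂(d - i))`. -/
def w (i : ℕ) : ℕ × ℕ :=
  (omega ((A₁ a).erase 0) (d a) i, omega ((A₂ a).erase 0) (d a) (d a - i))

/-- `δ₁(u)`, the degree of the first component of `u` with respect to `A₁ \ {0}`. -/
def delta₁ (u : ℕ × ℕ) : ℕ∞ := delta ((A₁ a).erase 0) u.1

/-- `δ₂(u)`, the degree of the second component of `u` with respect to `A₂ \ {0}`. -/
def delta₂ (u : ℕ × ℕ) : ℕ∞ := delta ((A₂ a).erase 0) u.2

open Classical in
/-- The set `𝕀` of all `1 ≤ i ≤ d - 1` outside `{a_1, …, a_{k-1}}` with `δ₁(w_i) > deg(w_i)`. -/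
def II : Finset ℕ :=
  (Finset.Icc 1 (d a - 1)).filter fun i =>
    i ∉ inner a ∧ (deg a (w a i) : ℕ∞) < delta₁ a (w a i)

/-- The condition `δ₁(w_i) = δ₂(w_i) = deg(w_i) + 1`. -/
def degreeCondition (i : ℕ) : Prop :=
  delta₁ a (w a i) = (deg a (w a i) : ℕ∞) + 1 ∧ delta₂ a (w a i) = (deg a (w a i) : ℕ∞) + 1

variable (K : Type u) [Field K]

/-- The semigroup ring `K[S]`. -/
abbrev KS : Type u := AddMonoidAlgebra K (S a)

/-- The maximal homogeneous ideal of `K[S]`, generated by the monomials `t^s`, `s ∈ S \ {0}`. -/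
def maxIdeal : Ideal (KS a K) :=
  Ideal.span {f | ∃ s : S a, s ≠ 0 ∧ f = AddMonoidAlgebra.single s 1}

/-- The first local cohomology module `H¹_𝔪(K[S])`, as a module over `K[S]`. -/
def H1 : ModuleCat.{u} (KS a K) :=
  (localCohomology (maxIdeal a K) 1).obj (ModuleCat.of (KS a K) (KS a K))

/-- `H¹_𝔪(K[S])` as a vector space over `K`. -/
def H1K : ModuleCat.{u} K :=
  (ModuleCat.restrictScalars (algebraMap K (KS a K))).obj (H1 a K)

/-- `K[S]` is Buchsbaum if `𝔪 H¹_𝔪(K[S]) = 0`. -/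
def IsBuchsbaum : Prop :=
  ∀ f ∈ maxIdeal a K, ∀ x : H1 a K, f • x = 0

/-- The line `K · u` in the polynomial ring `K[ℕ²]`, spanned by the monomial with exponent `u`. -/
def line (u : ℕ × ℕ) : Submodule K (AddMonoidAlgebra K (ℕ × ℕ)) :=
  Submodule.span K {AddMonoidAlgebra.single u 1}

end MonomialCurve

end

/-! Write R = K[S], T = K[ℕ²], x and y for the monomials with exponents (0,d) and (d,0). Both lie in
𝔪, and xⁿ, yⁿ behave like a regular sequence on T, so Hom(R/𝔪ⁿ, T) = Ext¹(R/𝔪ⁿ, T) = 0. The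
connecting map then identifies Ext¹(R/𝔪ⁿ, R) with the 𝔪ⁿ-torsion of T/R, and in the colimit H¹_𝔪(R)
is the 𝔪-power torsion of T/R (`localCohomology.nonempty_equiv_powTorsion`). As 𝔪 lies in the
radical of (xⁿ, yⁿ), this torsion is K[S']/K[S], where S' is the `saturation` of S
(`mk_mem_powTorsion_iff`).

The rest is mostly combinatorics of S' \ S. Membership of u in S means d ∣ u₁ + u₂ and δ₁(u) ≤ deg
u, or equally δ₂(u) ≤ deg u; membership in S' only asks that these δ be finite. Hence S' is the
union of the quadrants w_i + ℕ(d,0) + ℕ(0,d), and 𝕀 is the set of i with w_i ∉ S. Condition (*) says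
that both neighbours w_i + (0,d) and w_i + (d,0) are in S; if it holds on 𝕀, then S' \ S = {w_i : i
∈ 𝕀} (`mem_saturation_diff_iff`). This gives (ii), and with `isBuchsbaum_iff` also the Buchsbaum
criterion.

For (i), if S' = S, then at each maximal ideal suitable monic polynomials in x and in y form a
regular sequence of length two, which is the full dimension (`isWeaklyRegular_aeval`). If S' ≠ S,
some f ∈ T \ R satisfies 𝔪f ⊆ R (`exists_socle`), and this contradicts depth two at 𝔪. -/

noncomputable section

/-! ### Functoriality of Ext and cohomology classes of cocycles -/

section
open CategoryTheory Limits Opposite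
namespace CategoryTheory.ProjectiveResolution
variable {R : Type u} [CommRing R] {X X' : ModuleCat.{u} R}

/-- The map on Hom-complexes induced by precomposition with a chain map. -/
def linearYonedaMap {P P' : ChainComplex (ModuleCat.{u} R) ℕ} (φ : P' ⟶ P) (Y : ModuleCat.{u} R) :
    P.linearYonedaObj R Y ⟶ P'.linearYonedaObj R Y :=
  (HomologicalComplex.unopFunctor _ _).map
    ((((linearYoneda R (ModuleCat.{u} R)).obj Y).rightOp.mapHomologicalComplex _).map φ).op

/-- `Ext` is the left derived functor of the opposite of Hom, so any lift `φ` of `h` computes the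
induced map. The auxiliary `h5` and `h6` only carry the isomorphisms through `unop`. -/
lemma ext_map_app (h : X' ⟶ X) (P : ProjectiveResolution X) (P' : ProjectiveResolution X')
    (φ : P'.complex ⟶ P.complex)
    (w : φ ≫ P.π = P'.π ≫ (ChainComplex.single₀ (ModuleCat.{u} R)).map h) (n : ℕ) (Y : ModuleCat.{u} R) :
    ((Ext R (ModuleCat.{u} R) n).map h.op).app Y ≫ (P'.isoExt n Y).hom = (P.isoExt n Y).hom ≫
      HomologicalComplex.homologyMap (linearYonedaMap φ Y) n := by
  have h1 := Functor.leftDerived_map_eq ((linearYoneda R (ModuleCat.{u} R)).obj Y).rightOp n h φ w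
  have h2 : ((Ext R (ModuleCat.{u} R) n).map h.op).app Y =
    ((((linearYoneda R (ModuleCat.{u} R)).obj Y).rightOp.leftDerived n).map h).unop := rfl
  have h3 := HomologicalComplex.homologyOp_hom_naturality (linearYonedaMap φ Y) n
  have h5 : ∀ {A B A' B' : (ModuleCat.{u} R)ᵒᵖ} (a : A ≅ B) (a' : A' ≅ B') (m : B' ⟶ B)
      {U U' : ModuleCat.{u} R}
      (f : unop B ⟶ U) (f' : unop B' ⟶ U') (ψ : U ⟶ U') (h : m.unop ≫ f' = f ≫ ψ),
      (a'.hom ≫ m ≫ a.inv).unop ≫ a'.inv.unop ≫ f' = (a.inv.unop ≫ f) ≫ ψ := by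
    intro A B A' B' a a' m U U' f f' ψ h
    rw [Category.assoc, ← h, ← Category.assoc, ← unop_comp]
    simp
  have h6 : ∀ {H H' : (ModuleCat.{u} R)ᵒᵖ} {V V' : ModuleCat.{u} R} (o : H ≅ op V) (o' : H' ≅ op V')
      (m : H' ⟶ H) (ψ : V ⟶ V') (h : m ≫ o.hom = o'.hom ≫ ψ.op),
      m.unop ≫ o'.unop.inv = o.unop.inv ≫ ψ := by
    intro H H' V V' o o' m ψ h
    refine Quiver.Hom.op_inj ?_
    change o'.inv ≫ m = ψ.op ≫ o.inv
    rw [Iso.inv_comp_eq, ← Category.assoc, ← h]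
    simp
  rw [h2, h1]
  refine h5 _ _ _ _ _ _ ?_
  exact h6 _ _ _ _ h3
end CategoryTheory.ProjectiveResolution
namespace HomologicalComplex
variable {R : Type u} [CommRing R] (K : CochainComplex (ModuleCat.{u} R) ℕ)

/-- The map sending a cocycle to its cohomology class. -/
def cocycleClass : LinearMap.ker (K.d 1 2).hom →ₗ[R] K.homology 1 :=
  (K.liftCycles (A := ModuleCat.of R (LinearMap.ker (K.d 1 2).hom)) (i := 1)
    (ModuleCat.ofHom (LinearMap.ker (K.d 1 2).hom).subtype) 2 (by simp)
    (by ext x; exact x.2) ≫ K.homologyπ 1).hom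

lemma iCycles_liftCycles_ker (x : LinearMap.ker (K.d 1 2).hom) :
    K.iCycles 1 (K.liftCycles (A := ModuleCat.of R (LinearMap.ker (K.d 1 2).hom)) (i := 1)
    (ModuleCat.ofHom (LinearMap.ker (K.d 1 2).hom).subtype) 2 (by simp)
    (by ext x; exact x.2) x) = x.1 := by
  rw [← ConcreteCategory.comp_apply, K.liftCycles_i]
  rfl

lemma cocycleClass_surjective : Function.Surjective K.cocycleClass := by
  intro x
  obtain ⟨z, rfl⟩ := (ModuleCat.epi_iff_surjective (K.homologyπ 1)).1 inferInstance x
  refine ⟨⟨K.iCycles 1 z, ?_⟩, ?_⟩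
  · rw [LinearMap.mem_ker]
    change (K.d 1 2) (K.iCycles 1 z) = 0
    rw [← ConcreteCategory.comp_apply, K.iCycles_d]
    rfl
  · refine congrArg (K.homologyπ 1) ?_
    apply (ModuleCat.mono_iff_injective (K.iCycles 1)).1 inferInstance
    exact K.iCycles_liftCycles_ker _

lemma cocycleClass_eq_zero_iff (x : LinearMap.ker (K.d 1 2).hom) :
    K.cocycleClass x = 0 ↔ ∃ y, K.d 0 1 y = x.1 := by
  have hex := ShortComplex.exact_of_g_is_cokernel
    (ShortComplex.mk (K.toCycles 0 1) (K.homologyπ 1) (by simp)) (K.homologyIsCokernel 0 1 (by simp))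
  rw [ShortComplex.moduleCat_exact_iff] at hex
  have hd : ∀ y, K.iCycles 1 (K.toCycles 0 1 y) = K.d 0 1 y := fun y ↦ by
    rw [← ConcreteCategory.comp_apply, K.toCycles_i]
  constructor
  · intro h
    obtain ⟨y, hy⟩ := hex _ h
    refine ⟨y, ?_⟩
    rw [← hd, ← K.iCycles_liftCycles_ker x]
    exact congrArg (K.iCycles 1) hy
  · rintro ⟨y, hy⟩
    change K.homologyπ 1 _ = 0
    have : K.toCycles 0 1 y = (K.liftCycles (A := ModuleCat.of R (LinearMap.ker (K.d 1 2).hom))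
        (i := 1) (ModuleCat.ofHom (LinearMap.ker (K.d 1 2).hom).subtype) 2 (by simp)
        (by ext x; exact x.2) x) := by
      apply (ModuleCat.mono_iff_injective (K.iCycles 1)).1 inferInstance
      rw [hd, hy]
      exact (K.iCycles_liftCycles_ker x).symm
    refine (congrArg (K.homologyπ 1) this.symm).trans ?_
    rw [← ConcreteCategory.comp_apply, K.toCycles_comp_homologyπ]
    rfl

lemma homologyMap_cocycleClass {K L : CochainComplex (ModuleCat.{u} R) ℕ} (ψ : K ⟶ L)
    (x : LinearMap.ker (K.d 1 2).hom) (y : LinearMap.ker (L.d 1 2).hom) (h : ψ.f 1 x.1 = y.1) :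
    homologyMap ψ 1 (K.cocycleClass x) = L.cocycleClass y := by
  change homologyMap ψ 1 (K.homologyπ 1 _) = L.homologyπ 1 _
  rw [← ConcreteCategory.comp_apply, homologyπ_naturality, ConcreteCategory.comp_apply]
  congr 1
  apply (ModuleCat.mono_iff_injective (L.iCycles 1)).1 inferInstance
  rw [← ConcreteCategory.comp_apply, cyclesMap_i, ConcreteCategory.comp_apply]
  refine (congrArg (ψ.f 1) (K.iCycles_liftCycles_ker x)).trans (h.trans ?_)
  exact (L.iCycles_liftCycles_ker y).symm

end HomologicalComplex

end

/-! ### Ext¹ by cocycles on a projective resolution -/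

section
open CategoryTheory Limits Opposite
namespace CategoryTheory.ProjectiveResolution
variable {R : Type u} [CommRing R] {X X' : ModuleCat.{u} R} (P : ProjectiveResolution X)

lemma π_surjective : Function.Surjective (P.π.f 0) :=
  (ModuleCat.epi_iff_surjective (P.π.f 0)).1 inferInstance

lemma π_d (p : P.complex.X 1) : P.π.f 0 (P.complex.d 1 0 p) = 0 := by
  rw [← ConcreteCategory.comp_apply, P.complex_d_comp_π_f_zero]
  rfl

lemma d_d (p : P.complex.X 2) : P.complex.d 1 0 (P.complex.d 2 1 p) = 0 := by
  rw [← ConcreteCategory.comp_apply, P.complex.d_comp_d]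
  rfl

lemma exists_of_π_eq_zero (p : P.complex.X 0) (h : P.π.f 0 p = 0) :
    ∃ q, P.complex.d 1 0 q = p := by
  have := P.exact₀
  rw [ShortComplex.moduleCat_exact_iff] at this
  exact this p h

lemma exists_of_d_eq_zero (p : P.complex.X 1) (h : P.complex.d 1 0 p = 0) :
    ∃ q, P.complex.d 2 1 q = p := by
  have := P.exact_succ 0
  rw [ShortComplex.moduleCat_exact_iff] at this
  exact this p h

lemma _root_.ModuleCat.iso_inv_hom_apply {A B : ModuleCat.{u} R} (e : A ≅ B) (b : B) :
    e.hom (e.inv b) = b := by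
  rw [← ConcreteCategory.comp_apply, Iso.inv_hom_id]
  rfl

lemma _root_.ModuleCat.iso_hom_inv_apply {A B : ModuleCat.{u} R} (e : A ≅ B) (a : A) :
    e.inv (e.hom a) = a := by
  rw [← ConcreteCategory.comp_apply, Iso.hom_inv_id]
  rfl

/-- The class in `Ext¹` of a cocycle on a projective resolution. -/
def extClass (Y : ModuleCat.{u} R) :
    LinearMap.ker ((P.complex.linearYonedaObj R Y).d 1 2).hom →ₗ[R]
      ((Ext R (ModuleCat.{u} R) 1).obj (op X)).obj Y :=
  (P.isoExt 1 Y).inv.hom ∘ₗ (P.complex.linearYonedaObj R Y).cocycleClass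

lemma extClass_surjective (Y : ModuleCat.{u} R) : Function.Surjective (P.extClass Y) := by
  intro x
  obtain ⟨f, hf⟩ := (P.complex.linearYonedaObj R Y).cocycleClass_surjective ((P.isoExt 1 Y).hom x)
  exact ⟨f, (congrArg (P.isoExt 1 Y).inv hf).trans (ModuleCat.iso_hom_inv_apply _ _)⟩

lemma extClass_eq_zero_iff (Y : ModuleCat.{u} R)
    (x : LinearMap.ker ((P.complex.linearYonedaObj R Y).d 1 2).hom) :
    P.extClass Y x = 0 ↔ ∃ g : P.complex.X 0 ⟶ Y, P.complex.d 1 0 ≫ g = x.1 := by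
  refine Iff.trans ⟨fun h ↦ ?_, fun h ↦ ?_⟩
    ((P.complex.linearYonedaObj R Y).cocycleClass_eq_zero_iff x)
  · apply Function.LeftInverse.injective (ModuleCat.iso_inv_hom_apply (P.isoExt 1 Y))
    exact h.trans (map_zero _).symm
  · exact (congrArg (P.isoExt 1 Y).inv h).trans (map_zero _)

lemma ext_map_extClass (P' : ProjectiveResolution X') (h : X' ⟶ X) (φ : P'.complex ⟶ P.complex)
    (w : φ ≫ P.π = P'.π ≫ (ChainComplex.single₀ (ModuleCat.{u} R)).map h) (Y : ModuleCat.{u} R)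
    (x : LinearMap.ker ((P.complex.linearYonedaObj R Y).d 1 2).hom)
    (y : LinearMap.ker ((P'.complex.linearYonedaObj R Y).d 1 2).hom)
    (hxy : (y.1 : P'.complex.X 1 ⟶ Y) = φ.f 1 ≫ (x.1 : P.complex.X 1 ⟶ Y)) :
    ((Ext R (ModuleCat.{u} R) 1).map h.op).app Y (P.extClass Y x) = P'.extClass Y y := by
  apply Function.LeftInverse.injective (ModuleCat.iso_hom_inv_apply (P'.isoExt 1 Y))
  rw [← ConcreteCategory.comp_apply, ext_map_app h P P' φ w, ConcreteCategory.comp_apply]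
  refine (congrArg (HomologicalComplex.homologyMap (linearYonedaMap φ Y) 1) 
    (ModuleCat.iso_inv_hom_apply (P.isoExt 1 Y) _)).trans ?_
  refine Eq.trans ?_ (ModuleCat.iso_inv_hom_apply (P'.isoExt 1 Y) _).symm
  exact HomologicalComplex.homologyMap_cocycleClass _ x y hxy.symm
end CategoryTheory.ProjectiveResolution

end

/-! ### The connecting homomorphism Hom(R/I, T/M) → Ext¹(R/I, M) -/

section
open CategoryTheory Limits Opposite
namespace CategoryTheory.ProjectiveResolution
variable {R : Type u} [CommRing R]

/-- The augmentation map of a projective resolution. -/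
def augmentation {X : ModuleCat.{u} R} (P : ProjectiveResolution X) : P.complex.X 0 →ₗ[R] X :=
  (P.π.f 0).hom

/-- A `1`-cocycle of `Hom(P, Y)`, as a map `P₁ ⟶ Y`. -/
def cocycleHom {X : ModuleCat.{u} R} {P : ProjectiveResolution X} {Y : ModuleCat.{u} R}
    (f : LinearMap.ker ((P.complex.linearYonedaObj R Y).d 1 2).hom) : P.complex.X 1 ⟶ Y :=
  f.1

lemma d_comp_cocycleHom {X : ModuleCat.{u} R} {P : ProjectiveResolution X} {Y : ModuleCat.{u} R}
    (f : LinearMap.ker ((P.complex.linearYonedaObj R Y).d 1 2).hom) :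
    P.complex.d 2 1 ≫ cocycleHom f = 0 :=
  f.2

variable {I : Ideal R} (P : ProjectiveResolution (ModuleCat.of R (R ⧸ I)))
  {M T : Type u} [AddCommGroup M] [Module R M] [AddCommGroup T] [Module R T] (i : M →ₗ[R] T)

/-- For an embedding `i : M → T`, the relation between classes in `Ext¹(R/I, M)` and elements of
`T` given by the connecting homomorphism: `x` is the image of the class of `c` in
`Hom(R/I, T/M)`. -/
def ConnectingRel (x : ((Ext R (ModuleCat.{u} R) 1).obj (op (ModuleCat.of R (R ⧸ I)))).obj
    (ModuleCat.of R M)) (c : T) : Prop :=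
  ∃ (f : LinearMap.ker ((P.complex.linearYonedaObj R (ModuleCat.of R M)).d 1 2).hom)
    (g : P.complex.X 0 →ₗ[R] T), P.extClass _ f = x ∧
    (∀ p, i (cocycleHom f p) = g (P.complex.d 1 0 p)) ∧
    ∀ p (r : R), P.augmentation p = (Submodule.Quotient.mk r : R ⧸ I) →
      r • c - g p ∈ LinearMap.range i

variable {P i}

lemma ConnectingRel.add {x y c e} (hx : P.ConnectingRel i x c) (hy : P.ConnectingRel i y e) :
    P.ConnectingRel i (x + y) (c + e) := by
  obtain ⟨f, g, hf, hfg, hg⟩ := hx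
  obtain ⟨f', g', hf', hfg', hg'⟩ := hy
  refine ⟨f + f', g + g', by rw [map_add, hf, hf'], fun p ↦ ?_, fun p r hr ↦ ?_⟩
  · rw [LinearMap.add_apply, ← hfg, ← hfg', ← map_add]
    rfl
  · rw [LinearMap.add_apply, smul_add, add_sub_add_comm]
    exact add_mem (hg p r hr) (hg' p r hr)

lemma ConnectingRel.smul {x c} (s : R) (hx : P.ConnectingRel i x c) :
    P.ConnectingRel i (s • x) (s • c) := by
  obtain ⟨f, g, hf, hfg, hg⟩ := hx
  refine ⟨s • f, s • g, by rw [map_smul, hf], fun p ↦ ?_, fun p r hr ↦ ?_⟩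
  · rw [LinearMap.smul_apply, ← hfg, ← map_smul]
    rfl
  · rw [LinearMap.smul_apply, smul_comm, ← smul_sub]
    exact Submodule.smul_mem _ _ (hg p r hr)

lemma ConnectingRel.smul_mem {x c} (hx : P.ConnectingRel i x c) {r : R} (hr : r ∈ I) :
    r • c ∈ LinearMap.range i := by
  obtain ⟨f, g, hf, hfg, hg⟩ := hx
  have := hg 0 r (by rw [map_zero]; exact ((Submodule.Quotient.mk_eq_zero I).2 hr).symm)
  simpa using this

lemma smul_augmentation {r : R} (hr : r ∈ I) (p : P.complex.X 0) :
    P.augmentation (r • p) = 0 := by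
  rw [map_smul]
  obtain ⟨s, hs⟩ := Submodule.Quotient.mk_surjective I (P.augmentation p)
  rw [← hs]
  change (Submodule.Quotient.mk (r • s) : R ⧸ I) = 0
  exact (Submodule.Quotient.mk_eq_zero I).2 (I.mul_mem_right _ hr)

/-- If `f` is the coboundary of `h`, then `g` and `i ∘ h` agree on boundaries. Every `a • p` with `a
∈ I` is a boundary and `a` is regular on `T`, so they agree everywhere; a lift `p` of 1 then puts
`c` in `M`. -/
lemma ConnectingRel.mem_range {c} (hI : ∃ a ∈ I, IsSMulRegular T a) (hx : P.ConnectingRel i 0 c) :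
    c ∈ LinearMap.range i := by
  obtain ⟨f, g, hf, hfg, hg⟩ := hx
  obtain ⟨a, ha, hreg⟩ := hI
  obtain ⟨h, hh⟩ := (P.extClass_eq_zero_iff _ f).1 hf
  have key : ∀ p, g p = i (h p) := by
    intro p
    apply hreg
    obtain ⟨q, hq⟩ := P.exists_of_π_eq_zero (a • p) (smul_augmentation ha p)
    change a • g p = a • i (h p)
    have hh' : cocycleHom f q = h (P.complex.d 1 0 q) :=
      (ConcreteCategory.congr_hom (hh : _ = cocycleHom f) q).symm
    rw [← map_smul, ← hq, ← hfg, hh', hq, map_smul, map_smul]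
  obtain ⟨p, hp⟩ := P.π_surjective (Submodule.Quotient.mk (1 : R) : R ⧸ I)
  have := hg p 1 hp
  rw [one_smul, key] at this
  simpa using add_mem this (LinearMap.mem_range_self i (h p))

/-- If `c` comes from `M`, then so do all values of `g`, which becomes a cochain in `M` with
coboundary `f`. -/
lemma ConnectingRel.eq_zero {x c} (hi : Function.Injective i) (hx : P.ConnectingRel i x c)
    (hc : c ∈ LinearMap.range i) : x = 0 := by
  obtain ⟨f, g, rfl, hfg, hg⟩ := hx
  rw [P.extClass_eq_zero_iff]
  have key : ∀ p, g p ∈ LinearMap.range i := by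
    intro p
    obtain ⟨r, hr⟩ := Submodule.Quotient.mk_surjective I (P.augmentation p)
    have := sub_mem (Submodule.smul_mem _ r hc) (hg p r hr.symm)
    simpa using this
  let e := LinearEquiv.ofInjective i hi
  let h : P.complex.X 0 →ₗ[R] M := e.symm ∘ₗ g.codRestrict (LinearMap.range i) key
  have hh : ∀ p, i (h p) = g p := fun p ↦ by
    have := e.apply_symm_apply (g.codRestrict (LinearMap.range i) key p)
    exact congrArg Subtype.val this
  refine ⟨ModuleCat.ofHom h, ?_⟩
  ext p
  apply hi
  exact (hh _).trans (hfg p).symm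

variable (P) in
-- The element `c` defines a map R/I → T/M. Projectivity of P₀ lifts it to `g : P₀ → T`, and `g ∘ d`
-- lands in `M` and is the cocycle.
lemma exists_connectingRel_of_smul_mem (hi : Function.Injective i) {c : T}
    (hc : ∀ r ∈ I, r • c ∈ LinearMap.range i) : ∃ x, P.ConnectingRel i x c := by
  let φ : (R ⧸ I) →ₗ[R] T ⧸ LinearMap.range i :=
    I.liftQ ((LinearMap.range i).mkQ ∘ₗ LinearMap.toSpanSingleton R T c) (fun r hr ↦ by
      rw [LinearMap.mem_ker, LinearMap.comp_apply, ← LinearMap.mem_ker, Submodule.ker_mkQ]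
      exact hc r hr)
  have := P.projective 0
  rw [← IsProjective.iff_projective] at this
  obtain ⟨g, hg⟩ := Module.projective_lifting_property (LinearMap.range i).mkQ
    (φ ∘ₗ P.augmentation) (Submodule.mkQ_surjective _)
  have hg' : ∀ p, (LinearMap.range i).mkQ (g p) = φ (P.augmentation p) := fun p ↦
    LinearMap.congr_fun hg p
  have key : ∀ p, g (P.complex.d 1 0 p) ∈ LinearMap.range i := by
    intro p
    rw [← Submodule.ker_mkQ (LinearMap.range i), LinearMap.mem_ker, hg']
    have : P.augmentation (P.complex.d 1 0 p) = 0 := P.π_d p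
    rw [this, map_zero]
  let e := LinearEquiv.ofInjective i hi
  let f : P.complex.X 1 →ₗ[R] M :=
    e.symm ∘ₗ (g ∘ₗ (P.complex.d 1 0).hom).codRestrict (LinearMap.range i) key
  have hf : ∀ p, i (f p) = g (P.complex.d 1 0 p) := fun p ↦
    congrArg Subtype.val (e.apply_symm_apply
      ((g ∘ₗ (P.complex.d 1 0).hom).codRestrict (LinearMap.range i) key p))
  have hf' : P.complex.d 2 1 ≫ ModuleCat.ofHom f = 0 := by
    ext p
    apply hi
    exact (hf _).trans ((congrArg g (P.d_d p)).trans ((map_zero g).trans (map_zero i).symm))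
  refine ⟨_, ⟨ModuleCat.ofHom f, hf'⟩, g, rfl, hf, fun p r hr ↦ ?_⟩
  rw [← Submodule.ker_mkQ (LinearMap.range i), LinearMap.mem_ker, map_sub, hg', hr, sub_eq_zero]
  rfl

/-- This is the vanishing of Ext¹(R/I, T) made explicit: the cocycle extends to `g : P₀ → T` by `g p
= i (f q) / a`, where `d q = a • p`. The second element `b` of the pair makes the division possible.
-/
lemma exists_connectingRel (hI : ∃ a ∈ I, ∃ b ∈ I, IsSMulRegular T a ∧
      ∀ s t : T, a • s = b • t → ∃ v, t = a • v)
    (x : ((Ext R (ModuleCat.{u} R) 1).obj (op (ModuleCat.of R (R ⧸ I)))).obj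
    (ModuleCat.of R M)) : ∃ c, P.ConnectingRel i x c := by
  obtain ⟨f, rfl⟩ := P.extClass_surjective _ x
  obtain ⟨a, ha, b, hb, hreg, hab⟩ := hI
  let f' : P.complex.X 1 →ₗ[R] M := (cocycleHom f).hom
  have hf' : ∀ q, f' (P.complex.d 2 1 q) = 0 := fun q ↦
    ConcreteCategory.congr_hom (d_comp_cocycleHom f) q
  have hker : ∀ q, P.complex.d 1 0 q = 0 → f' q = 0 := fun q hq ↦ by
    obtain ⟨q', rfl⟩ := P.exists_of_d_eq_zero q hq
    exact hf' q'
  have key : ∀ p, ∃ v : T, ∀ q, P.complex.d 1 0 q = a • p → i (f' q) = a • v := by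
    intro p
    obtain ⟨q, hq⟩ := P.exists_of_π_eq_zero (a • p) (smul_augmentation ha p)
    obtain ⟨q', hq'⟩ := P.exists_of_π_eq_zero (b • p) (smul_augmentation hb p)
    -- The chains `a • q'` and `b • q` have the same boundary, so the cocycle takes equal values on
    -- them.
    obtain ⟨v, hv⟩ := hab (i (f' q')) (i (f' q)) (by
      rw [← map_smul, ← map_smul, ← map_smul, ← map_smul, ← sub_eq_zero, ← map_sub, ← map_sub,
        hker _ (by
          have : P.complex.d 1 0 (a • q' - b • q) = a • (b • p) - b • (a • p) := by
            rw [map_sub, map_smul, map_smul, hq, hq']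
          rw [this, smul_comm, sub_self]), map_zero])
    refine ⟨v, fun q₁ hq₁ ↦ ?_⟩
    rw [← hv, ← sub_eq_zero, ← map_sub, ← map_sub,
      hker _ (by rw [map_sub, hq, hq₁, sub_self]), map_zero]
  choose g₀ hg₀ using key
  have hex : ∀ p, ∃ q, P.complex.d 1 0 q = a • p := fun p ↦
    P.exists_of_π_eq_zero (a • p) (smul_augmentation ha p)
  let g : P.complex.X 0 →ₗ[R] T :=
    { toFun := g₀
      map_add' := fun p p' ↦ by
        obtain ⟨q, hq⟩ := hex p
        obtain ⟨q', hq'⟩ := hex p'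
        apply hreg
        change a • g₀ (p + p') = a • (g₀ p + g₀ p')
        rw [← hg₀ (p + p') (q + q') (by rw [map_add, hq, hq', smul_add]), smul_add, ← hg₀ p q hq,
          ← hg₀ p' q' hq', map_add, map_add]
      map_smul' := fun s p ↦ by
        obtain ⟨q, hq⟩ := hex p
        apply hreg
        change a • g₀ (s • p) = a • (s • g₀ p)
        rw [← hg₀ (s • p) (s • q) (by rw [map_smul, hq, smul_comm]), smul_comm, ← hg₀ p q hq,
          map_smul, map_smul] }
  have hg : ∀ q, i (f' q) = g (P.complex.d 1 0 q) := fun q ↦ by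
    apply hreg
    change a • i (f' q) = a • g₀ _
    rw [← hg₀ _ (a • q) (by rw [map_smul]), map_smul, map_smul]
  obtain ⟨p, hp⟩ := P.π_surjective (Submodule.Quotient.mk (1 : R) : R ⧸ I)
  refine ⟨g p, f, g, rfl, hg, fun p' r hr ↦ ?_⟩
  have : P.augmentation (r • p - p') = 0 := by
    have hp' : P.augmentation p = (Submodule.Quotient.mk (1 : R) : R ⧸ I) := hp
    rw [map_sub, map_smul, hp', hr, sub_eq_zero]
    change (Submodule.Quotient.mk (r • (1 : R)) : R ⧸ I) = _
    rw [smul_eq_mul, mul_one]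
  obtain ⟨q, hq⟩ := P.exists_of_π_eq_zero _ this
  rw [← map_smul, ← map_sub, ← hq, ← hg]
  exact LinearMap.mem_range_self _ _

lemma ConnectingRel.map {I' : Ideal R} {P' : ProjectiveResolution (ModuleCat.of R (R ⧸ I'))}
    (hI : I' ≤ I) {x c} (hx : P.ConnectingRel i x c) :
    P'.ConnectingRel i (((Ext R (ModuleCat.{u} R) 1).map
      (ModuleCat.ofHom (Submodule.mapQ I' I LinearMap.id hI) :
        ModuleCat.of R (R ⧸ I') ⟶ ModuleCat.of R (R ⧸ I)).op).app (ModuleCat.of R M) x) c := by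
  obtain ⟨f, g, rfl, hfg, hg⟩ := hx
  let h : ModuleCat.of R (R ⧸ I') ⟶ ModuleCat.of R (R ⧸ I) :=
    ModuleCat.ofHom (Submodule.mapQ I' I LinearMap.id hI)
  let φ := ProjectiveResolution.lift h P' P
  have w := ProjectiveResolution.lift_commutes h P' P
  have h10 : ∀ q, φ.f 0 (P'.complex.d 1 0 q) = P.complex.d 1 0 (φ.f 1 q) := fun q ↦ by
    rw [← ConcreteCategory.comp_apply, ← ConcreteCategory.comp_apply, φ.comm]
  have h21 : φ.f 2 ≫ P.complex.d 2 1 = P'.complex.d 2 1 ≫ φ.f 1 := φ.comm 2 1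
  have hf2 : P.complex.d 2 1 ≫ cocycleHom f = 0 := d_comp_cocycleHom f
  have hcoc : P'.complex.d 2 1 ≫ φ.f 1 ≫ cocycleHom f = 0 := by
    rw [← Category.assoc, ← h21, Category.assoc, hf2, comp_zero]
  refine ⟨⟨φ.f 1 ≫ cocycleHom f, hcoc⟩, g ∘ₗ (φ.f 0).hom, ?_,
    fun p ↦ ?_, fun p r hr ↦ ?_⟩
  · exact (P.ext_map_extClass P' h φ w _ f _ rfl).symm
  · refine (hfg (φ.f 1 p)).trans ?_
    rw [← h10]
    rfl
  · refine hg _ r ?_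
    have := ConcreteCategory.congr_hom (congrArg (fun α ↦ HomologicalComplex.Hom.f α 0) w) p
    refine Eq.trans this ?_
    change h (P'.augmentation p) = _
    rw [hr]
    rfl
end CategoryTheory.ProjectiveResolution

end

/-! ### H¹_J(M) as the power torsion of T/M -/

section
open CategoryTheory Limits Opposite

/-- The elements of a module annihilated by some power of the ideal `J`. -/
def Ideal.powTorsion {R : Type*} [CommRing R] (J : Ideal R) (N : Type*) [AddCommGroup N]
    [Module R N] : Submodule R N where
  carrier := {c | ∃ n : ℕ, ∀ r ∈ J ^ n, r • c = 0}
  add_mem' := by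
    rintro c e ⟨n, hn⟩ ⟨m, hm⟩
    refine ⟨n + m, fun r hr ↦ ?_⟩
    rw [smul_add, hn r (Ideal.pow_le_pow_right (Nat.le_add_right n m) hr),
      hm r (Ideal.pow_le_pow_right (Nat.le_add_left m n) hr), add_zero]
  zero_mem' := ⟨0, fun r _ ↦ smul_zero r⟩
  smul_mem' := by
    rintro s c ⟨n, hn⟩
    exact ⟨n, fun r hr ↦ by rw [smul_comm, hn r hr, smul_zero]⟩

namespace localCohomology
open ProjectiveResolution
variable {R : Type u} [CommRing R] {M T : Type u} [AddCommGroup M] [Module R M] [AddCommGroup T]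
  [Module R T] {J : Ideal R}

/-- An ideal contains a pair of elements behaving like a regular sequence on `T`. -/
def HasRegularPair (J : Ideal R) (T : Type*) [AddCommGroup T] [Module R T] : Prop :=
  ∃ a ∈ J, ∃ b ∈ J, IsSMulRegular T a ∧ ∀ s t : T, a • s = b • t → ∃ v, t = a • v

variable {i : M →ₗ[R] T} (hi : Function.Injective i)

section
variable {I : Ideal R} (hI : HasRegularPair I T)

lemma connectingRel_congr (hI : HasRegularPair I T)
    {P : ProjectiveResolution (ModuleCat.of R (R ⧸ I))} {x c e}
    (h : P.ConnectingRel i x c) (h' : P.ConnectingRel i x e) :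
    (LinearMap.range i).mkQ c = (LinearMap.range i).mkQ e := by
  rw [← sub_eq_zero, ← map_sub, ← LinearMap.mem_ker, Submodule.ker_mkQ, sub_eq_add_neg]
  have := h.add (h'.smul (-1))
  rw [neg_one_smul, neg_one_smul, add_neg_cancel] at this
  obtain ⟨a, ha, b, hb, h, -⟩ := hI
  exact this.mem_range ⟨a, ha, h⟩

variable (i) in
/-- The inverse of the connecting map `Hom(R/I, T/M) → Ext¹(R/I, M)`, with values in `T/M`. -/
def extToQuotient :
    ((Ext R (ModuleCat.{u} R) 1).obj (op (ModuleCat.of R (R ⧸ I)))).obj (ModuleCat.of R M) →ₗ[R]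
      T ⧸ LinearMap.range i :=
  have h := exists_connectingRel (P := projectiveResolution (ModuleCat.of R (R ⧸ I))) (i := i) hI
  { toFun := fun x ↦ (LinearMap.range i).mkQ (h x).choose
    map_add' := fun x y ↦ by
      rw [← map_add]
      exact connectingRel_congr hI (h (x + y)).choose_spec
        ((h x).choose_spec.add (h y).choose_spec)
    map_smul' := fun s x ↦ by
      rw [RingHom.id_apply, ← map_smul]
      exact connectingRel_congr hI (h (s • x)).choose_spec ((h x).choose_spec.smul s) }

lemma exists_connectingRel_extToQuotient (x) : ∃ c, extToQuotient i hI x = (LinearMap.range i).mkQ c ∧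
    (projectiveResolution (ModuleCat.of R (R ⧸ I))).ConnectingRel i x c :=
  ⟨_, rfl, (exists_connectingRel hI x).choose_spec⟩

lemma ConnectingRel.extToQuotient_eq {x c}
    (h : (projectiveResolution (ModuleCat.of R (R ⧸ I))).ConnectingRel i x c) :
    extToQuotient i hI x = (LinearMap.range i).mkQ c := by
  obtain ⟨e, he, h'⟩ := exists_connectingRel_extToQuotient hI x
  rw [he, connectingRel_congr hI h h']

include hi in
lemma extToQuotient_injective : Function.Injective (extToQuotient i hI) := by
  rw [injective_iff_map_eq_zero]
  intro x hx
  obtain ⟨c, hc, h⟩ := exists_connectingRel_extToQuotient hI x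
  refine h.eq_zero hi ?_
  rw [← Submodule.ker_mkQ (LinearMap.range i), LinearMap.mem_ker, ← hc, hx]

include hi in
lemma mem_range_extToQuotient (c : T ⧸ LinearMap.range i) :
    (∃ x, extToQuotient i hI x = c) ↔ ∀ r ∈ I, r • c = 0 := by
  constructor
  · rintro ⟨x, rfl⟩ r hr
    obtain ⟨c, hc, h⟩ := exists_connectingRel_extToQuotient hI x
    rw [hc, ← map_smul, ← LinearMap.mem_ker, Submodule.ker_mkQ]
    exact h.smul_mem hr
  · intro h
    obtain ⟨c, rfl⟩ := Submodule.mkQ_surjective _ c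
    obtain ⟨x, hx⟩ := exists_connectingRel_of_smul_mem
      (projectiveResolution (ModuleCat.of R (R ⧸ I))) hi (c := c) (fun r hr ↦ by
        rw [← Submodule.ker_mkQ (LinearMap.range i), LinearMap.mem_ker, map_smul, h r hr])
    exact ⟨x, ConnectingRel.extToQuotient_eq hI hx⟩
end

/-- Each Ext¹(R/Jⁿ, M) is the Jⁿ-torsion of T/M. By `ConnectingRel.map` the transition maps keep the
element `c`, so they become inclusions and the colimit is the union. -/
theorem nonempty_equiv_powTorsion (hi : Function.Injective i) (hJ : ∀ n, HasRegularPair (J ^ n) T) :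
    Nonempty ((localCohomology J 1).obj (ModuleCat.of R M) ≃ₗ[R]
      J.powTorsion (T ⧸ LinearMap.range i)) := by
  let F := diagram (idealPowersDiagram J) 1
  let G := F ⋙ (evaluation (ModuleCat.{u} R) (ModuleCat.{u} R)).obj (ModuleCat.of R M)
  let e : (localCohomology J 1).obj (ModuleCat.of R M) ≅ colimit G :=
    colimitObjIsoColimitCompEvaluation F (ModuleCat.of R M)
  let c : Cocone G :=
    { pt := ModuleCat.of R (T ⧸ LinearMap.range i)
      ι :=
        { app := fun t ↦ ModuleCat.ofHom (extToQuotient i (hJ t.unop.unop))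
          naturality := fun s t f ↦ by
            ext x
            obtain ⟨c, hc, h⟩ := exists_connectingRel_extToQuotient (i := i) (hJ s.unop.unop) x
            have := ConnectingRel.extToQuotient_eq (hJ t.unop.unop) (h.map
              (P' := projectiveResolution (ModuleCat.of R (R ⧸ J ^ t.unop.unop)))
              ((idealPowersDiagram J).map f.unop).down.down)
            exact this.trans hc.symm } }
  let θ := e.hom ≫ colimit.desc G c
  have hθ : ∀ t x, θ (e.inv (colimit.ι G t x)) = extToQuotient i (hJ t.unop.unop) x := by
    intro t x
    change colimit.desc G c (e.hom (e.inv _)) = _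
    rw [ModuleCat.iso_inv_hom_apply, ← ConcreteCategory.comp_apply, colimit.ι_desc]
    rfl
  have hrep : ∀ y, ∃ t x, e.inv (colimit.ι G t x) = y := by
    intro y
    have : PreservesFilteredColimitsOfSize.{0, 0} (forget (ModuleCat.{u} R)) :=
      preservesFilteredColimitsOfSize_shrink.{0, u, 0, u} _
    have := PreservesFilteredColimitsOfSize.preserves_filtered_colimits
      (F := forget (ModuleCat.{u} R)) ℕᵒᵖᵒᵖ
    obtain ⟨t, x, hx⟩ := Concrete.colimit_exists_rep G (e.hom y)
    exact ⟨t, x, by rw [hx, ModuleCat.iso_hom_inv_apply]⟩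
  have hinj : Function.Injective θ.hom := by
    rw [injective_iff_map_eq_zero]
    intro y hy
    obtain ⟨t, x, rfl⟩ := hrep y
    have : x = 0 := extToQuotient_injective hi (hJ t.unop.unop)
      (((hθ t x).symm.trans hy).trans (map_zero _).symm)
    rw [this, map_zero, map_zero]
  have hrange : LinearMap.range θ.hom = J.powTorsion (T ⧸ LinearMap.range i) := by
    ext z
    constructor
    · rintro ⟨y, rfl⟩
      obtain ⟨t, x, rfl⟩ := hrep y
      exact ⟨t.unop.unop, (mem_range_extToQuotient hi (hJ t.unop.unop) _).1 ⟨x, (hθ t x).symm⟩⟩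
    · rintro ⟨n, hn⟩
      obtain ⟨x, hx⟩ := (mem_range_extToQuotient hi (hJ n) _).2 hn
      exact ⟨_, (hθ (op (op n)) x).trans hx⟩
  exact ⟨LinearEquiv.ofInjective θ.hom hinj ≪≫ₗ LinearEquiv.ofEq _ _ hrange⟩
end localCohomology

end

/-! ### The functions δ and ω of a numerical semigroup -/

namespace MonomialCurve

lemma delta_le_iff {A : Finset ℕ} {n m : ℕ} :
    delta A n ≤ m ↔ ∃ x : ℕ → ℕ, ∑ α ∈ A, x α * α = n ∧ ∑ α ∈ A, x α ≤ m := by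
  constructor
  · intro h
    by_contra! hx
    have : ((m + 1 : ℕ) : ℕ∞) ≤ delta A n :=
      le_iInf₂ fun x hxn ↦ by exact_mod_cast hx x hxn
    have := this.trans h
    norm_cast at this
    omega
  · rintro ⟨x, hx, hm⟩
    exact (iInf₂_le x hx).trans (by exact_mod_cast hm)

lemma mem_closure_iff_delta {A : Finset ℕ} {n : ℕ} :
    n ∈ AddSubmonoid.closure (A : Set ℕ) ↔ ∃ m : ℕ, delta A n ≤ m := by
  simp_rw [delta_le_iff]
  constructor
  · intro h
    induction h using AddSubmonoid.closure_induction with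
    | mem α hα =>
      exact ⟨_, Pi.single α 1, by simp [Pi.single_apply, Finset.mem_coe.1 hα], le_rfl⟩
    | zero => exact ⟨0, 0, by simp, by simp⟩
    | add p q _ _ hp hq =>
      obtain ⟨_, x, hx, -⟩ := hp
      obtain ⟨_, y, hy, -⟩ := hq
      exact ⟨_, x + y, by simp [add_mul, Finset.sum_add_distrib, hx, hy], le_rfl⟩
  · rintro ⟨m, x, rfl, -⟩
    exact sum_mem fun α hα ↦ by
      simpa using nsmul_mem (AddSubmonoid.subset_closure (Finset.mem_coe.2 hα)) (x α)

/-- Membership in the semigroup generated by the points `(α, d - α)`, `α ∈ A`. -/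
lemma mem_closure_image_iff {A : Finset ℕ} {d : ℕ} (hd : 0 < d) (hA : ∀ α ∈ A, α ≤ d)
    (h0 : 0 ∈ A) (u : ℕ × ℕ) :
    u ∈ AddSubmonoid.closure ((fun α ↦ (α, d - α)) '' (A : Set ℕ)) ↔
      d ∣ u.1 + u.2 ∧ delta (A.erase 0) u.1 ≤ ((u.1 + u.2) / d : ℕ) := by
  rw [delta_le_iff]
  constructor
  · intro h
    induction h using AddSubmonoid.closure_induction with
    | mem v hv =>
      obtain ⟨α, hα, rfl⟩ := hv
      have h1 : α + (d - α) = d := by have := hA α hα; omega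
      simp only [h1, Nat.div_self hd, dvd_refl, true_and]
      rcases eq_or_ne α 0 with rfl | hne
      · exact ⟨0, by simp, by simp⟩
      · have : α ∈ A.erase 0 := Finset.mem_erase.2 ⟨hne, hα⟩
        exact ⟨Pi.single α 1, by simp [Pi.single_apply, this],
          by simp [Pi.single_apply, this]⟩
    | zero => exact ⟨by simp, 0, by simp, by simp⟩
    | add p q _ _ hp hq =>
      obtain ⟨hp, x, hx, hx'⟩ := hp
      obtain ⟨hq, y, hy, hy'⟩ := hq
      have h1 : (p + q).1 + (p + q).2 = (p.1 + p.2) + (q.1 + q.2) := by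
        simp only [Prod.fst_add, Prod.snd_add]; ring
      rw [h1, Nat.add_div_of_dvd_right hp]
      refine ⟨dvd_add hp hq, x + y, ?_, ?_⟩
      · simp [add_mul, Finset.sum_add_distrib, hx, hy]
      · simpa [Finset.sum_add_distrib] using add_le_add hx' hy'
  · rintro ⟨⟨m, hm⟩, x, hx, hx'⟩
    rw [hm, Nat.mul_div_cancel_left _ hd] at hx'
    have h1 : ∑ α ∈ A.erase 0, x α • ((α, d - α) : ℕ × ℕ) ∈
        AddSubmonoid.closure ((fun α ↦ (α, d - α)) '' (A : Set ℕ)) :=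
      sum_mem fun α hα ↦ nsmul_mem (AddSubmonoid.subset_closure
        (Set.mem_image_of_mem _ (Finset.mem_coe.2 (Finset.mem_of_mem_erase hα)))) _
    -- Copies of (0,d), the generator for `α = 0`, fill the degree up to `m` without changing the
    -- first coordinate.
    have h2 : (m - ∑ α ∈ A.erase 0, x α) • ((0, d) : ℕ × ℕ) ∈
        AddSubmonoid.closure ((fun α ↦ (α, d - α)) '' (A : Set ℕ)) :=
      nsmul_mem (AddSubmonoid.subset_closure
        (Set.mem_image_of_mem (fun α ↦ (α, d - α)) (Finset.mem_coe.2 h0))) _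
    have h3 : ∑ α ∈ A.erase 0, x α * (d - α) + ∑ α ∈ A.erase 0, x α * α =
        (∑ α ∈ A.erase 0, x α) * d := by
      rw [← Finset.sum_add_distrib, Finset.sum_mul]
      refine Finset.sum_congr rfl fun α hα ↦ ?_
      rw [← mul_add, Nat.sub_add_cancel (hA α (Finset.mem_of_mem_erase hα))]
    convert add_mem h1 h2
    ext
    · simp [Prod.fst_sum, hx]
    · have h4 : (m - ∑ α ∈ A.erase 0, x α) * d + (∑ α ∈ A.erase 0, x α) * d = d * m := by
        rw [← add_mul, Nat.sub_add_cancel hx', mul_comm]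
      simp only [Prod.snd_add, Prod.snd_sum, Prod.smul_snd, smul_eq_mul]
      omega

variable {k : ℕ} {a : Fin (k + 1) → ℕ}

/-- The two numerical semigroups meet every residue class. -/
lemma omega_spec {A : Finset ℕ} {d : ℕ} (hA : Nat.setGcd (A : Set ℕ) = 1) (hd : 0 < d) (i : ℕ) :
    omega A d i ∈ AddSubmonoid.closure (A : Set ℕ) ∧ omega A d i ≡ i [MOD d] := by
  refine Nat.sInf_mem (s := {n : ℕ | n ∈ AddSubmonoid.closure (A : Set ℕ) ∧ n ≡ i [MOD d]}) ?_
  obtain ⟨n, hn⟩ := Nat.exists_mem_closure_of_ge (A : Set ℕ)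
  refine ⟨i + n * d, hn _ ?_ (by rw [hA]; exact one_dvd _), by simp [Nat.ModEq]⟩
  nlinarith

lemma omega_le {A : Finset ℕ} {d i n : ℕ} (hn : n ∈ AddSubmonoid.closure (A : Set ℕ))
    (h : n ≡ i [MOD d]) : omega A d i ≤ n :=
  Nat.sInf_le ⟨hn, h⟩

lemma exists_eq_omega_add {A : Finset ℕ} {d i n : ℕ} (hA : Nat.setGcd (A : Set ℕ) = 1) (hd : 0 < d)
    (hn : n ∈ AddSubmonoid.closure (A : Set ℕ)) (h : n ≡ i [MOD d]) :
    ∃ p, n = omega A d i + p * d := by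
  have h1 := omega_le hn h
  have h2 := (Nat.modEq_iff_dvd' h1).1 ((omega_spec hA hd i).2.trans h.symm)
  obtain ⟨p, hp⟩ := h2
  exact ⟨p, by rw [mul_comm]; omega⟩

lemma omega_eq_self {A : Finset ℕ} {d i : ℕ} (hA : Nat.setGcd (A : Set ℕ) = 1)
    (hi : i ∈ A) (hid : i < d) : omega A d i = i := by
  refine (omega_le (AddSubmonoid.subset_closure (Finset.mem_coe.2 hi)) rfl).antisymm ?_
  have := (omega_spec hA (by omega : 0 < d) i).2
  rw [Nat.ModEq, Nat.mod_eq_of_lt hid] at this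
  have h := Nat.mod_le (omega A d i) d
  rwa [this] at h

end MonomialCurve

/-! ### The semigroup S, its saturation and the points w_i -/

namespace MonomialCurve
variable {k : ℕ} {a : Fin (k + 1) → ℕ}

/-- The standing assumptions on the exponents `0 = a_0 < ⋯ < a_k`. -/
structure Admissible (a : Fin (k + 1) → ℕ) : Prop where
  k_pos : 0 < k
  zero : a 0 = 0
  strictMono : StrictMono a
  gcd_eq_one : Finset.univ.gcd a = 1

namespace Admissible
variable (h : Admissible a)
include h

lemma d_pos : 0 < d a := by
  have := h.strictMono (show (0 : Fin (k + 1)) < Fin.last k from by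
    rw [Fin.lt_def]; simpa using h.k_pos)
  rw [h.zero] at this
  exact this

lemma le_d (j : Fin (k + 1)) : a j ≤ d a := h.strictMono.monotone (Fin.le_last j)

lemma zero_mem_A₁ : 0 ∈ A₁ a := Finset.mem_image.2 ⟨0, Finset.mem_univ _, h.zero⟩

omit h in
lemma zero_mem_A₂ : 0 ∈ A₂ a :=
  Finset.mem_image.2 ⟨Fin.last k, Finset.mem_univ _, Nat.sub_self _⟩

lemma le_d_of_mem_A₁ : ∀ α ∈ A₁ a, α ≤ d a := by
  intro α hα
  obtain ⟨j, -, rfl⟩ := Finset.mem_image.1 hα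
  exact h.le_d j

omit h in
lemma le_d_of_mem_A₂ : ∀ α ∈ A₂ a, α ≤ d a := by
  intro α hα
  obtain ⟨j, -, rfl⟩ := Finset.mem_image.1 hα
  exact Nat.sub_le _ _

lemma setGcd_A₁ : Nat.setGcd ((A₁ a).erase 0 : Finset ℕ) = 1 := by
  rw [← Nat.dvd_one, ← h.gcd_eq_one]
  refine Finset.dvd_gcd fun j _ ↦ ?_
  rcases eq_or_ne (a j) 0 with h0 | h0
  · rw [h0]; exact dvd_zero _
  · exact Nat.setGcd_dvd_of_mem (Finset.mem_coe.2 (Finset.mem_erase.2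
      ⟨h0, Finset.mem_image_of_mem _ (Finset.mem_univ j)⟩))

lemma setGcd_A₂ : Nat.setGcd ((A₂ a).erase 0 : Finset ℕ) = 1 := by
  rw [← Nat.dvd_one, ← h.gcd_eq_one]
  have key : ∀ j, Nat.setGcd ((A₂ a).erase 0 : Finset ℕ) ∣ d a - a j := by
    intro j
    rcases eq_or_ne (d a - a j) 0 with h0 | h0
    · rw [h0]; exact dvd_zero _
    · exact Nat.setGcd_dvd_of_mem (Finset.mem_coe.2 (Finset.mem_erase.2
        ⟨h0, Finset.mem_image_of_mem (fun j ↦ d a - a j) (Finset.mem_univ j)⟩))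
  have hd : Nat.setGcd ((A₂ a).erase 0 : Finset ℕ) ∣ d a := by simpa [h.zero] using key 0
  refine Finset.dvd_gcd fun j _ ↦ ?_
  have := Nat.dvd_sub hd (key j)
  rwa [Nat.sub_sub_self (h.le_d j)] at this

lemma mem_S_iff_delta₁ (u : ℕ × ℕ) :
    u ∈ S a ↔ d a ∣ u.1 + u.2 ∧ delta₁ a u ≤ deg a u := by
  have : S a = AddSubmonoid.closure ((fun α ↦ (α, d a - α)) '' (A₁ a : Set ℕ)) := by
    rw [S, A₁, Finset.coe_image, Set.image_image]
    simp [e]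
  rw [this, mem_closure_image_iff h.d_pos h.le_d_of_mem_A₁ h.zero_mem_A₁]
  rfl

/-- Swapping the coordinates exchanges the roles of A₁ and A₂. -/
lemma mem_S_iff_delta₂ (u : ℕ × ℕ) :
    u ∈ S a ↔ d a ∣ u.1 + u.2 ∧ delta₂ a u ≤ deg a u := by
  have h1 : (S a).map (AddEquiv.prodComm (M := ℕ) (N := ℕ)).toAddMonoidHom =
      AddSubmonoid.closure ((fun α ↦ (α, d a - α)) '' (A₂ a : Set ℕ)) := by
    rw [S, AddMonoidHom.map_mclosure, A₂, Finset.coe_image, Set.image_image, ← Set.range_comp]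
    congr 1
    ext v
    simp [e, Nat.sub_sub_self (h.le_d _)]
  have h2 : u ∈ S a ↔ u.swap ∈ (S a).map (AddEquiv.prodComm (M := ℕ) (N := ℕ)).toAddMonoidHom := by
    rw [AddSubmonoid.mem_map]
    constructor
    · intro hu
      exact ⟨u, hu, rfl⟩
    · rintro ⟨v, hv, hvu⟩
      have : v = u := Prod.swap_injective hvu
      rwa [← this]
  rw [h2, h1, mem_closure_image_iff h.d_pos le_d_of_mem_A₂ zero_mem_A₂]
  rw [Prod.fst_swap, Prod.snd_swap, add_comm u.2 u.1]
  rfl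

lemma zero_d_mem_S : (0, d a) ∈ S a :=
  AddSubmonoid.subset_closure ⟨0, by simp [e, h.zero]⟩

omit h in
lemma d_zero_mem_S : (d a, 0) ∈ S a :=
  AddSubmonoid.subset_closure ⟨Fin.last k, by simp [e, d]⟩

end Admissible

/-- The points that some multiples of `(0, d)` and of `(d, 0)` move into `S`. -/
def saturation (a : Fin (k + 1) → ℕ) : Set (ℕ × ℕ) :=
  {u | ∃ n : ℕ, u + n • (0, d a) ∈ S a ∧ u + n • (d a, 0) ∈ S a}

lemma add_mem_saturation {u s : ℕ × ℕ} (hu : u ∈ saturation a) (hs : s ∈ S a) :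
    u + s ∈ saturation a := by
  obtain ⟨n, h1, h2⟩ := hu
  refine ⟨n, ?_, ?_⟩ <;> rw [add_right_comm]
  exacts [add_mem h1 hs, add_mem h2 hs]

namespace Admissible
variable (h : Admissible a)
include h

lemma deg_add (u : ℕ × ℕ) (n : ℕ) :
    deg a (u + n • (0, d a)) = deg a u + n ∧ deg a (u + n • (d a, 0)) = deg a u + n := by
  have h1 : (u + n • (0, d a)).1 + (u + n • (0, d a)).2 = u.1 + u.2 + d a * n := by simp; ring
  have h2 : (u + n • (d a, 0)).1 + (u + n • (d a, 0)).2 = u.1 + u.2 + d a * n := by simp; ring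
  simp only [deg, h1, h2, Nat.add_mul_div_left _ _ h.d_pos, and_self]

lemma add_nsmul_zero_d_mem_iff (u : ℕ × ℕ) (n : ℕ) :
    u + n • (0, d a) ∈ S a ↔ d a ∣ u.1 + u.2 ∧ delta₁ a u ≤ (deg a u + n : ℕ) := by
  rw [h.mem_S_iff_delta₁, (h.deg_add u n).1]
  refine and_congr ?_ ?_
  · have : (u + n • (0, d a)).1 + (u + n • (0, d a)).2 = u.1 + u.2 + n * d a := by simp; ring
    rw [this, Nat.dvd_add_left (dvd_mul_left _ _)]
  · simp [delta₁]

lemma add_nsmul_d_zero_mem_iff (u : ℕ × ℕ) (n : ℕ) :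
    u + n • (d a, 0) ∈ S a ↔ d a ∣ u.1 + u.2 ∧ delta₂ a u ≤ (deg a u + n : ℕ) := by
  rw [h.mem_S_iff_delta₂, (h.deg_add u n).2]
  refine and_congr ?_ ?_
  · have : (u + n • (d a, 0)).1 + (u + n • (d a, 0)).2 = u.1 + u.2 + n * d a := by simp; ring
    rw [this, Nat.dvd_add_left (dvd_mul_left _ _)]
  · simp [delta₂]

/-- Adding n(0,d) keeps u₁ and raises the degree by n, so for large n only the finiteness of δ₁(u)
matters. The other axis is symmetric. -/
lemma mem_saturation_iff (u : ℕ × ℕ) :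
    u ∈ saturation a ↔ d a ∣ u.1 + u.2 ∧
      u.1 ∈ AddSubmonoid.closure (((A₁ a).erase 0 : Finset ℕ) : Set ℕ) ∧
      u.2 ∈ AddSubmonoid.closure (((A₂ a).erase 0 : Finset ℕ) : Set ℕ) := by
  simp only [mem_closure_iff_delta]
  simp only [saturation, Set.mem_ofPred_eq, h.add_nsmul_zero_d_mem_iff, h.add_nsmul_d_zero_mem_iff]
  constructor
  · rintro ⟨n, ⟨h1, h2⟩, -, h3⟩
    exact ⟨h1, ⟨_, h2⟩, ⟨_, h3⟩⟩
  · rintro ⟨h1, ⟨m, h2⟩, ⟨m', h3⟩⟩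
    exact ⟨m + m', ⟨h1, h2.trans (by norm_cast; omega)⟩, h1, h3.trans (by norm_cast; omega)⟩

lemma w_mem_saturation {i : ℕ} (hi : i ≤ d a) : w a i ∈ saturation a := by
  have h1 := omega_spec h.setGcd_A₁ h.d_pos i
  have h2 := omega_spec h.setGcd_A₂ h.d_pos (d a - i)
  rw [h.mem_saturation_iff]
  refine ⟨?_, h1.1, h2.1⟩
  rw [← Nat.modEq_zero_iff_dvd]
  refine (h1.2.add h2.2).trans ?_
  rw [Nat.add_sub_cancel' hi]
  exact (Nat.modEq_zero_iff_dvd).2 dvd_rfl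

lemma exists_eq_w_add {u : ℕ × ℕ} (hu : u ∈ saturation a) :
    ∃ p q : ℕ, u = w a (u.1 % d a) + p • (d a, 0) + q • (0, d a) := by
  obtain ⟨h1, h2, h3⟩ := (h.mem_saturation_iff u).1 hu
  have hlt := Nat.mod_lt u.1 h.d_pos
  obtain ⟨p, hp⟩ := exists_eq_omega_add h.setGcd_A₁ h.d_pos h2
    (Nat.mod_modEq u.1 (d a)).symm
  obtain ⟨q, hq⟩ := exists_eq_omega_add (i := d a - u.1 % d a) h.setGcd_A₂ h.d_pos
    h3 (by
      refine Nat.ModEq.add_left_cancel (Nat.mod_modEq u.1 (d a)).symm ?_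
      rw [Nat.add_sub_cancel' hlt.le]
      exact ((Nat.modEq_zero_iff_dvd).2 h1).trans ((Nat.modEq_zero_iff_dvd).2 dvd_rfl).symm)
  refine ⟨p, q, Prod.ext ?_ ?_⟩
  · simpa [w] using hp
  · simpa [w] using hq

lemma w_fst_mod {i : ℕ} (hi : i < d a) : (w a i).1 % d a = i := by
  have h1 := (omega_spec h.setGcd_A₁ h.d_pos i).2
  rwa [Nat.ModEq, Nat.mod_eq_of_lt hi] at h1

omit h in
lemma w_zero : w a 0 = 0 := by
  refine Prod.ext (Nat.le_zero.1 (omega_le (zero_mem _) rfl))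
    (Nat.le_zero.1 (omega_le (zero_mem _) ?_))
  exact ((Nat.modEq_zero_iff_dvd).2 (dvd_refl (d a))).symm

lemma w_eq_e {i : ℕ} (hi : i ∈ inner a) : w a i = e a i := by
  obtain ⟨j, hj, rfl⟩ := Finset.mem_image.1 hi
  obtain ⟨hj0, hj1⟩ := Finset.mem_Ioo.1 hj
  have h0 : 0 < a j := h.zero ▸ h.strictMono hj0
  have h1 : a j < d a := h.strictMono hj1
  refine Prod.ext (omega_eq_self h.setGcd_A₁ (Finset.mem_erase.2 ⟨h0.ne',
    Finset.mem_image_of_mem _ (Finset.mem_univ j)⟩) h1) (omega_eq_self h.setGcd_A₂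
    (Finset.mem_erase.2 ⟨by omega,
    Finset.mem_image_of_mem (fun j ↦ d a - a j) (Finset.mem_univ j)⟩) (by omega))

omit h in
lemma e_mem_S {i : ℕ} (hi : i ∈ inner a) : e a i ∈ S a := by
  obtain ⟨j, -, rfl⟩ := Finset.mem_image.1 hi
  exact AddSubmonoid.subset_closure ⟨j, rfl⟩

/-- The exclusions in the definition of 𝕀 are automatic: w₀ = 0 and w_h = e_h for h among a_1, …,
a_{k-1}, and these lie in S. -/
lemma mem_II_iff {i : ℕ} : i ∈ II a ↔ i < d a ∧ w a i ∉ S a := by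
  rw [II, Finset.mem_filter, Finset.mem_Icc]
  constructor
  · rintro ⟨⟨h1, h2⟩, -, h4⟩
    refine ⟨by omega, fun hS ↦ ?_⟩
    exact absurd ((h.mem_S_iff_delta₁ _).1 hS).2 (not_le.2 h4)
  · rintro ⟨h1, h2⟩
    have h0 : i ≠ 0 := by
      rintro rfl
      exact h2 (w_zero ▸ zero_mem _)
    refine ⟨by omega, fun hi ↦ h2 (h.w_eq_e hi ▸ e_mem_S hi), ?_⟩
    by_contra hlt
    exact h2 ((h.mem_S_iff_delta₁ _).2
      ⟨((h.mem_saturation_iff _).1 (h.w_mem_saturation h1.le)).1, not_lt.1 hlt⟩)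

lemma mod_mem_II {u : ℕ × ℕ} (hu : u ∈ saturation a) (hu' : u ∉ S a) : u.1 % d a ∈ II a := by
  rw [h.mem_II_iff]
  refine ⟨Nat.mod_lt _ h.d_pos, fun hS ↦ hu' ?_⟩
  obtain ⟨p, q, hpq⟩ := h.exists_eq_w_add hu
  rw [hpq]
  exact add_mem (add_mem hS (nsmul_mem d_zero_mem_S p)) (nsmul_mem h.zero_d_mem_S q)

lemma II_eq_empty_iff : II a = ∅ ↔ ∀ u ∈ saturation a, u ∈ S a := by
  constructor
  · intro hI u hu
    by_contra hu'
    simpa [hI] using h.mod_mem_II hu hu'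
  · intro hS
    refine Finset.eq_empty_of_forall_notMem fun i hi ↦ ?_
    rw [h.mem_II_iff] at hi
    exact hi.2 (hS _ (h.w_mem_saturation hi.1.le))

lemma w_injOn {i j : ℕ} (hi : i ∈ II a) (hj : j ∈ II a) (hij : w a i = w a j) : i = j := by
  rw [← h.w_fst_mod (h.mem_II_iff.1 hi).1, hij, h.w_fst_mod (h.mem_II_iff.1 hj).1]

/-- Since w_i ∉ S, both δ₁ and δ₂ are at least deg + 1. Only the upper bounds are left, and they say
that the two translates lie in S. -/
lemma degreeCondition_iff {i : ℕ} (hi : i ∈ II a) :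
    degreeCondition a i ↔ w a i + (0, d a) ∈ S a ∧ w a i + (d a, 0) ∈ S a := by
  obtain ⟨h1, h2⟩ := h.mem_II_iff.1 hi
  have hd := ((h.mem_saturation_iff _).1 (h.w_mem_saturation h1.le)).1
  have e1 := h.add_nsmul_zero_d_mem_iff (w a i) 1
  have e2 := h.add_nsmul_d_zero_mem_iff (w a i) 1
  rw [one_smul] at e1 e2
  have n1 : (deg a (w a i) : ℕ∞) + 1 ≤ delta₁ a (w a i) :=
    Order.add_one_le_of_lt (not_le.1 fun hle ↦ h2 ((h.mem_S_iff_delta₁ _).2 ⟨hd, hle⟩))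
  have n2 : (deg a (w a i) : ℕ∞) + 1 ≤ delta₂ a (w a i) :=
    Order.add_one_le_of_lt (not_le.1 fun hle ↦ h2 ((h.mem_S_iff_delta₂ _).2 ⟨hd, hle⟩))
  rw [e1, e2, degreeCondition]
  push_cast
  constructor
  · rintro ⟨h3, h4⟩
    exact ⟨⟨hd, h3.le⟩, hd, h4.le⟩
  · rintro ⟨⟨-, h3⟩, -, h4⟩
    exact ⟨h3.antisymm n1, h4.antisymm n2⟩

/-- A point of the saturation is w_i + p(d,0) + q(0,d); as soon as p or q is positive, the degree
condition puts it in S. -/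
lemma mem_saturation_diff_iff (hc : ∀ i ∈ II a, degreeCondition a i) (u : ℕ × ℕ) :
    (u ∈ saturation a ∧ u ∉ S a) ↔ ∃ i ∈ II a, w a i = u := by
  constructor
  · rintro ⟨hu, hu'⟩
    have hi := h.mod_mem_II hu hu'
    obtain ⟨h1, h2⟩ := (h.degreeCondition_iff hi).1 (hc _ hi)
    refine ⟨_, hi, ?_⟩
    obtain ⟨p, q, hpq⟩ := h.exists_eq_w_add hu
    generalize u.1 % d a = i at *
    rcases p with _ | p
    · rcases q with _ | q
      · simp [hpq]
      · refine absurd ?_ hu'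
        rw [hpq, zero_smul, add_zero, add_smul, one_smul, add_comm (q • _), ← add_assoc]
        exact add_mem h1 (nsmul_mem h.zero_d_mem_S q)
    · refine absurd ?_ hu'
      rw [hpq, add_smul, one_smul, add_comm (p • _), ← add_assoc]
      exact add_mem (add_mem h2 (nsmul_mem d_zero_mem_S p)) (nsmul_mem h.zero_d_mem_S q)
  · rintro ⟨i, hi, rfl⟩
    have := h.mem_II_iff.1 hi
    exact ⟨h.w_mem_saturation this.1.le, this.2⟩

/-- Of the d - 1 candidates, the k - 1 inner exponents are excluded. -/
lemma card_II_le : (II a).card ≤ d a - k := by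
  have h1 : II a ⊆ (Finset.Icc 1 (d a - 1)) \ inner a := by
    intro i hi
    obtain ⟨h1, h2, -⟩ := Finset.mem_filter.1 hi
    exact Finset.mem_sdiff.2 ⟨h1, h2⟩
  have h2 : inner a ⊆ Finset.Icc 1 (d a - 1) := by
    intro i hi
    obtain ⟨j, hj, rfl⟩ := Finset.mem_image.1 hi
    obtain ⟨hj0, hj1⟩ := Finset.mem_Ioo.1 hj
    have h0 : 0 < a j := h.zero ▸ h.strictMono hj0
    have h1 : a j < d a := h.strictMono hj1
    exact Finset.mem_Icc.2 (by omega)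
  have h3 : (inner a).card = k - 1 := by
    rw [inner, Finset.card_image_of_injective _ h.strictMono.injective, Fin.card_Ioo]
    simp
  have h4 := Finset.card_le_card h1
  rw [Finset.card_sdiff_of_subset h2, h3, Nat.card_Icc] at h4
  have := h.k_pos
  omega

/-- The combinatorial form of the Buchsbaum property. -/
lemma forall_add_mem_S_iff :
    (∀ u ∈ saturation a, ∀ s ∈ S a, s ≠ 0 → u + s ∈ S a) ↔
      (∀ i ∈ II a, degreeCondition a i) ∧
        ¬ ∃ i ∈ II a, ∃ j ∈ II a, ∃ l ∈ inner a, w a j = w a i + e a l := by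
  have hd := h.d_pos
  constructor
  · intro H
    refine ⟨fun i hi ↦ (h.degreeCondition_iff hi).2 ?_, ?_⟩
    · have hw := h.w_mem_saturation (h.mem_II_iff.1 hi).1.le
      exact ⟨H _ hw _ h.zero_d_mem_S (by simp [Prod.ext_iff, hd.ne']),
        H _ hw _ d_zero_mem_S (by simp [Prod.ext_iff, hd.ne'])⟩
    · rintro ⟨i, hi, j, hj, l, hl, hw⟩
      refine (h.mem_II_iff.1 hj).2 (hw ▸ H _ (h.w_mem_saturation (h.mem_II_iff.1 hi).1.le) _
        (e_mem_S hl) ?_)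
      intro h0
      obtain ⟨j, -, rfl⟩ := Finset.mem_image.1 hl
      have := h.le_d j
      simp only [e, Prod.mk_eq_zero] at h0
      omega
  · rintro ⟨hc, hne⟩ u hu s hs hs0
    by_cases huS : u ∈ S a
    · exact add_mem huS hs
    obtain ⟨i, hi, rfl⟩ := (h.mem_saturation_diff_iff hc u).1 ⟨hu, huS⟩
    obtain ⟨h1, h2⟩ := (h.degreeCondition_iff hi).1 (hc i hi)
    rw [S] at hs
    -- It suffices to split one generator off `s`: if `u` plus that generator is in S, then so is `u
    -- + s`. Axis generators are handled by the degree condition, inner ones by the exclusion of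
    -- pairs.
    induction hs using AddSubmonoid.closure_induction_left with
    | zero => exact absurd rfl hs0
    | add_left x hx y hy _ =>
      rw [← add_assoc]
      refine add_mem ?_ hy
      obtain ⟨j, rfl⟩ := hx
      rcases eq_or_ne j 0 with rfl | hj0
      · simpa [e, h.zero] using h1
      rcases eq_or_ne j (Fin.last k) with rfl | hj1
      · simpa [e, d] using h2
      have hl : a j ∈ inner a := Finset.mem_image_of_mem _ (Finset.mem_Ioo.2
        ⟨Fin.pos_iff_ne_zero.2 hj0, Fin.lt_last_iff_ne_last.2 hj1⟩)
      by_contra hS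
      obtain ⟨j', hj', hw⟩ := (h.mem_saturation_diff_iff hc _).1
        ⟨add_mem_saturation hu (e_mem_S hl), hS⟩
      exact hne ⟨i, hi, j', hj', _, hl, hw⟩
end Admissible
end MonomialCurve

/-! ### K[S] inside K[ℕ²], and its first local cohomology -/

namespace MonomialCurve
open AddMonoidAlgebra
variable {k : ℕ} (a : Fin (k + 1) → ℕ) (K : Type u) [Field K]

/-- The inclusion of `K[S]` into the polynomial ring `K[ℕ²]`. -/
def toPlane : KS a K →ₐ[K] AddMonoidAlgebra K (ℕ × ℕ) :=
  mapDomainAlgHom K K (S a).subtype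

instance : Algebra (KS a K) (AddMonoidAlgebra K (ℕ × ℕ)) := (toPlane a K).toRingHom.toAlgebra

instance : IsScalarTower K (KS a K) (AddMonoidAlgebra K (ℕ × ℕ)) :=
  IsScalarTower.of_algebraMap_eq fun r ↦ ((toPlane a K).commutes r).symm

/-- The inclusion of `K[S]` into `K[ℕ²]` as a map of `K[S]`-modules. -/
def incl : KS a K →ₗ[KS a K] AddMonoidAlgebra K (ℕ × ℕ) :=
  Algebra.linearMap (KS a K) (AddMonoidAlgebra K (ℕ × ℕ))

lemma incl_injective : Function.Injective (incl a K) :=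
  mapDomain_injective Subtype.val_injective

variable {a K}

lemma smul_eq_incl_mul (f : KS a K) (g : AddMonoidAlgebra K (ℕ × ℕ)) : f • g = incl a K f * g := rfl

lemma incl_mul (f g : KS a K) : incl a K (f * g) = incl a K f * incl a K g :=
  map_mul (toPlane a K) f g

lemma incl_single (s : S a) (r : K) : incl a K (single s r) = single s.1 r :=
  mapDomain_single

lemma mem_range_incl_iff {f : AddMonoidAlgebra K (ℕ × ℕ)} :
    f ∈ LinearMap.range (incl a K) ↔ ∀ u ∈ f.coeff.support, u ∈ S a := by
  constructor
  · rintro ⟨g, rfl⟩ u hu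
    classical
    have := Finsupp.mapDomain_support (f := (S a).subtype) (s := g.coeff) hu
    obtain ⟨s, -, rfl⟩ := Finset.mem_image.1 this
    exact s.2
  · intro h
    exact ⟨comapDomain Subtype.val Subtype.val_injective f,
      mapDomain_comapDomain (fun u hu ↦ ⟨⟨u, h u hu⟩, rfl⟩) _⟩

lemma support_single_smul (s : S a) (f : AddMonoidAlgebra K (ℕ × ℕ)) (u : ℕ × ℕ) :
    u ∈ ((single s 1 : KS a K) • f).coeff.support ↔ ∃ v ∈ f.coeff.support, v + s.1 = u := by
  rw [smul_eq_incl_mul, incl_single, support_coeff_single_mul f 1 (by simp)]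
  simp [add_comm]

lemma single_smul_mem_range_iff {s : S a} {f : AddMonoidAlgebra K (ℕ × ℕ)} :
    (single s 1 : KS a K) • f ∈ LinearMap.range (incl a K) ↔
      ∀ u ∈ f.coeff.support, u + s.1 ∈ S a := by
  simp only [mem_range_incl_iff, support_single_smul]
  exact ⟨fun h u hu ↦ h _ ⟨u, hu, rfl⟩, by rintro h u ⟨v, hv, rfl⟩; exact h v hv⟩

variable (K) in
/-- The monomial of `K[S]` with exponent `s`. -/
def mono {u : ℕ × ℕ} (hu : u ∈ S a) : KS a K := single ⟨u, hu⟩ 1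

lemma mono_pow {u : ℕ × ℕ} (hu : u ∈ S a) (n : ℕ) :
    mono K hu ^ n = mono K (nsmul_mem hu n) := by
  rw [mono, single_pow, one_pow]
  rfl

lemma mono_mul {u v : ℕ × ℕ} (hu : u ∈ S a) (hv : v ∈ S a) :
    mono K hu * mono K hv = mono K (add_mem hu hv) := by
  rw [mono, mono, single_mul_single, one_mul]
  rfl

lemma mono_mem_maxIdeal {u : ℕ × ℕ} (hu : u ∈ S a) (h0 : u ≠ 0) : mono K hu ∈ maxIdeal a K :=
  Ideal.subset_span ⟨⟨u, hu⟩, fun h ↦ h0 (congrArg Subtype.val h), rfl⟩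

lemma single_smul_apply_add {s : S a} (f : AddMonoidAlgebra K (ℕ × ℕ)) (u : ℕ × ℕ) :
    ((single s 1 : KS a K) • f).coeff (s.1 + u) = f.coeff u := by
  rw [smul_eq_incl_mul, incl_single, coeff_single_mul_add, one_mul]

instance : IsDomain (KS a K) :=
  (incl_injective a K).isDomain (toPlane a K).toRingHom

lemma smul_eq_zero_iff (f : KS a K) (g : AddMonoidAlgebra K (ℕ × ℕ)) :
    f • g = 0 ↔ f = 0 ∨ g = 0 := by
  rw [smul_eq_incl_mul, mul_eq_zero, ← map_zero (incl a K), (incl_injective a K).eq_iff, map_zero]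

instance : AddMonoid.FG (S a) := by
  rw [AddMonoid.fg_iff_addSubmonoid_fg]
  exact ⟨Finset.univ.image fun j ↦ e a (a j), by rw [Finset.coe_image]; simp [S]⟩

instance : IsNoetherianRing (KS a K) := Algebra.FiniteType.isNoetherianRing K _

namespace Admissible
variable (h : Admissible a)
include h

/-- The pair consists of the n-th powers of the two axis monomials, which are coprime in K[ℕ²]. -/
lemma hasRegularPair (n : ℕ) : localCohomology.HasRegularPair (maxIdeal a K ^ n)
    (AddMonoidAlgebra K (ℕ × ℕ)) := by
  have hd := h.d_pos
  refine ⟨mono K h.zero_d_mem_S ^ n, Ideal.pow_mem_pow (mono_mem_maxIdeal _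
    (by simp [Prod.ext_iff, hd.ne'])) n, mono K d_zero_mem_S ^ n, Ideal.pow_mem_pow
    (mono_mem_maxIdeal _ (by simp [Prod.ext_iff, hd.ne'])) n, ?_, ?_⟩
  · intro f g hfg
    rw [← sub_eq_zero] at hfg ⊢
    change mono K h.zero_d_mem_S ^ n • f - mono K h.zero_d_mem_S ^ n • g = 0 at hfg
    rw [← smul_sub, smul_eq_zero_iff] at hfg
    refine hfg.resolve_left (pow_ne_zero _ ?_)
    rw [mono]
    simp
  · intro s t hst
    rw [mono_pow, mono] at hst ⊢
    rw [mono_pow, mono] at hst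
    refine ⟨t.divOf (n • (0, d a)), ?_⟩
    ext u
    by_cases hu : ∃ v, n • (0, d a) + v = u
    · obtain ⟨v, rfl⟩ := hu
      exact (single_smul_apply_add (K := K) (s := ⟨_, nsmul_mem h.zero_d_mem_S n⟩)
        (t.divOf (n • (0, d a))) v).symm
    · push Not at hu
      rw [smul_eq_incl_mul, incl_single, coeff_single_mul_of_forall_add_ne _ _ hu]
      -- The coefficient of `t` at `u` is that of `t^{n(d,0)} • t = t^{n(0,d)} • s` at `u + n(d,0)`.
      -- It vanishes because the second coordinate is less than nd.
      have := single_smul_apply_add (K := K) (s := ⟨_, nsmul_mem (d_zero_mem_S (a := a)) n⟩) t u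
      rw [← this, ← hst, smul_eq_incl_mul, incl_single, coeff_single_mul_of_forall_add_ne]
      intro v hv
      refine hu (u - n • (0, d a)) (add_tsub_cancel_of_le ?_)
      have h1 := congrArg Prod.fst hv
      have h2 := congrArg Prod.snd hv
      simp at h1 h2
      refine ⟨by simp, by simp; omega⟩

omit h in
lemma nsmul_e (j : Fin (k + 1)) :
    d a • e a (a j) = a j • (d a, 0) + (d a - a j) • (0, d a) := by
  ext <;> simp [e, mul_comm]

lemma pow_mono_e (j : Fin (k + 1)) (hj : e a (a j) ∈ S a) : mono K hj ^ d a =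
    mono K d_zero_mem_S ^ (a j) * mono K h.zero_d_mem_S ^ (d a - a j) := by
  rw [mono_pow, mono_pow, mono_pow, mono_mul]
  simp only [mono, nsmul_e j]

/-- From d·e_h = h(d,0) + (d-h)(0,d), the d-th power of each generating monomial is a product of
powers of the axis monomials, at least one of them with positive exponent. -/
lemma maxIdeal_le_radical {I : Ideal (KS a K)} {n : ℕ} (h1 : mono K h.zero_d_mem_S ^ n ∈ I)
    (h2 : mono K d_zero_mem_S ^ n ∈ I) : maxIdeal a K ≤ I.radical := by
  have r1 : mono K h.zero_d_mem_S ∈ I.radical := ⟨n, h1⟩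
  have r2 : mono K (a := a) d_zero_mem_S ∈ I.radical := ⟨n, h2⟩
  refine Ideal.span_le.2 ?_
  rintro _ ⟨⟨s, hs⟩, hs0, rfl⟩
  replace hs0 : s ≠ 0 := fun h0 ↦ hs0 (Subtype.ext h0)
  change mono K hs ∈ I.radical
  have key : ∀ s (hs : s ∈ S a), s ≠ 0 → mono K hs ∈ I.radical := by
    intro s hs
    have hs' := hs
    rw [S] at hs'
    induction hs' using AddSubmonoid.closure_induction_left with
    | zero => exact fun h0 ↦ absurd rfl h0
    | add_left x hx y hy _ =>
      intro _
      have hxS : x ∈ S a := AddSubmonoid.subset_closure hx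
      rw [← mono_mul hxS hy]
      refine Ideal.mul_mem_right _ _ ?_
      obtain ⟨j, rfl⟩ := hx
      refine I.radical_idem ▸ ⟨d a, ?_⟩
      rw [h.pow_mono_e j hxS]
      rcases eq_or_ne (a j) 0 with h0 | h0
      · refine Ideal.mul_mem_left _ _ (Ideal.pow_mem_of_mem _ r1 _ ?_)
        have := h.d_pos
        omega
      · exact Ideal.mul_mem_right _ _ (Ideal.pow_mem_of_mem _ r2 _ (by omega))
  exact key s hs hs0

/-- The elements of `K[ℕ²] / K[S]` annihilated by a power of the maximal homogeneous ideal. -/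
lemma mk_mem_powTorsion_iff (f : AddMonoidAlgebra K (ℕ × ℕ)) :
    (LinearMap.range (incl a K)).mkQ f ∈ (maxIdeal a K).powTorsion _ ↔
      ∀ u ∈ f.coeff.support, u ∈ saturation a := by
  have hmk : ∀ r : KS a K, r • (LinearMap.range (incl a K)).mkQ f = 0 ↔
      r • f ∈ LinearMap.range (incl a K) := fun r ↦ by
    rw [← map_smul, ← LinearMap.mem_ker, Submodule.ker_mkQ]
  have hd := h.d_pos
  constructor
  · rintro ⟨n, hn⟩ u hu
    have h1 := (hmk _).1 (hn _ (Ideal.pow_mem_pow (mono_mem_maxIdeal (K := K) h.zero_d_mem_S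
      (by simp [Prod.ext_iff, hd.ne'])) n))
    have h2 := (hmk _).1 (hn _ (Ideal.pow_mem_pow (mono_mem_maxIdeal (K := K) d_zero_mem_S
      (by simp [Prod.ext_iff, hd.ne'])) n))
    rw [mono_pow, mono, single_smul_mem_range_iff] at h1 h2
    exact ⟨n, h1 u hu, h2 u hu⟩
  · intro hf
    let I : Ideal (KS a K) := LinearMap.ker (LinearMap.toSpanSingleton (KS a K) _
      ((LinearMap.range (incl a K)).mkQ f))
    have hI : ∀ r, r ∈ I ↔ r • f ∈ LinearMap.range (incl a K) := fun r ↦ by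
      rw [← hmk]; rfl
    choose! n hn1 hn2 using hf
    have hle : ∀ u ∈ f.coeff.support, n u ≤ ∑ v ∈ f.coeff.support, n v := fun u hu ↦
      Finset.single_le_sum (fun _ _ ↦ Nat.zero_le _) hu
    -- The sum of the exponents `n u` over the finite support serves as a uniform bound.
    have hm := h.maxIdeal_le_radical (K := K) (I := I) (n := ∑ v ∈ f.coeff.support, n v) (by
      rw [hI, mono_pow, mono, single_smul_mem_range_iff]
      intro u hu
      obtain ⟨p, hp⟩ := Nat.exists_eq_add_of_le (hle u hu)
      change u + _ • _ ∈ S a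
      rw [hp, add_smul, ← add_assoc]
      exact add_mem (hn1 u hu) (nsmul_mem h.zero_d_mem_S p)) (by
      rw [hI, mono_pow, mono, single_smul_mem_range_iff]
      intro u hu
      obtain ⟨p, hp⟩ := Nat.exists_eq_add_of_le (hle u hu)
      change u + _ • _ ∈ S a
      rw [hp, add_smul, ← add_assoc]
      exact add_mem (hn2 u hu) (nsmul_mem d_zero_mem_S p))
    obtain ⟨m, hm⟩ := Ideal.exists_pow_le_of_le_radical_of_fg hm (IsNoetherian.noetherian _)
    exact ⟨m, fun r hr ↦ (hmk r).2 ((hI r).1 (hm hr))⟩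

variable (K) in
/-- The first local cohomology of `K[S]` is the torsion submodule of `K[ℕ²] / K[S]`. -/
theorem nonempty_H1_equiv : Nonempty (H1 a K ≃ₗ[KS a K]
    (maxIdeal a K).powTorsion (AddMonoidAlgebra K (ℕ × ℕ) ⧸ LinearMap.range (incl a K))) :=
  localCohomology.nonempty_equiv_powTorsion (incl_injective a K) h.hasRegularPair

lemma isBuchsbaum_iff : IsBuchsbaum a K ↔
    ∀ u ∈ saturation a, ∀ s ∈ S a, s ≠ 0 → u + s ∈ S a := by
  obtain ⟨φ⟩ := h.nonempty_H1_equiv K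
  have hmk : ∀ (r : KS a K) f, r • (LinearMap.range (incl a K)).mkQ f = 0 ↔
      r • f ∈ LinearMap.range (incl a K) := fun r f ↦ by
    rw [← map_smul, ← LinearMap.mem_ker, Submodule.ker_mkQ]
  constructor
  · intro H u hu s hs hs0
    have hmem := (h.mk_mem_powTorsion_iff (K := K) (single u 1)).2 (by
      simpa [Finsupp.support_single] using hu)
    have h1 := congrArg (fun x ↦ (φ x).1) (H _ (mono_mem_maxIdeal hs hs0) (φ.symm ⟨_, hmem⟩))
    simp only [map_smul, LinearEquiv.apply_symm_apply, map_zero] at h1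
    have h2 := (hmk _ _).1 h1
    rw [mono, single_smul_mem_range_iff] at h2
    exact h2 u (by simp)
  · intro H f hf x
    apply φ.injective
    rw [map_smul, map_zero]
    obtain ⟨y, hy⟩ := φ x
    obtain ⟨g, rfl⟩ := Submodule.mkQ_surjective _ y
    ext1
    change f • (LinearMap.range (incl a K)).mkQ g = 0
    rw [h.mk_mem_powTorsion_iff] at hy
    induction hf using Submodule.span_induction with
    | mem f hf =>
      obtain ⟨s, hs0, rfl⟩ := hf
      rw [hmk, single_smul_mem_range_iff]
      exact fun u hu ↦ H u (hy u hu) s s.2 fun h0 ↦ hs0 (Subtype.ext h0)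
    | zero => rw [zero_smul]
    | add f f' _ _ hf hf' => rw [add_smul, hf, hf', add_zero]
    | smul r f _ hf => rw [smul_assoc, hf, smul_zero]

end Admissible
end MonomialCurve

/-! ### Socle elements and the length of torsion modules -/

/-- If n + 1 is the least power of `J` killing `v`, some `r ∈ J ^ n` has `r • v ≠ 0`, and `J` kills
`r • v`. -/
lemma Ideal.exists_ne_zero_smul_eq_zero_of_mem_powTorsion {R M : Type*} [CommRing R]
    [AddCommGroup M] [Module R M] {J : Ideal R} {v : M} (hv : v ∈ J.powTorsion M) (h0 : v ≠ 0) :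
    ∃ v' : M, v' ≠ 0 ∧ ∀ r ∈ J, r • v' = 0 := by
  classical
  obtain ⟨n, hn, hmin⟩ := Nat.findX (p := fun n ↦ ∀ r ∈ J ^ n, r • v = 0) hv
  rcases n with _ | n
  · exact absurd (by simpa using hn 1 (by simp)) h0
  · have := hmin n (Nat.lt_succ_self n)
    push Not at this
    obtain ⟨r, hr, hr0⟩ := this
    exact ⟨r • v, hr0, fun s hs ↦ by
      rw [smul_smul]; exact hn _ (by rw [pow_succ']; exact Ideal.mul_mem_mul hs hr)⟩

/-- If `R = K + J`, then the length of a finite-dimensional `J`-power torsion module is its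
dimension over `K`. -/
theorem Module.length_eq_finrank_of_powTorsion {K R : Type*} [Field K] [CommRing R] [Algebra K R]
    {J : Ideal R} (hJ : ∀ r : R, ∃ c : K, r - algebraMap K R c ∈ J) (n : ℕ) :
    ∀ (M : Type u) [AddCommGroup M] [Module R M] [Module K M] [IsScalarTower K R M]
      [Module.Finite K M], (∀ v : M, v ∈ J.powTorsion M) → Module.finrank K M = n →
      Module.length R M = n := by
  induction n with
  | zero =>
    intro M _ _ _ _ _ _ hM
    rw [Module.finrank_zero_iff] at hM
    rw [Module.length_eq_zero]
    rfl
  | succ n ih =>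
    intro M _ _ _ _ _ hJM hM
    have : Nontrivial M := Module.nontrivial_of_finrank_pos (R := K) (by omega)
    obtain ⟨v₀, hv₀⟩ := exists_ne (0 : M)
    obtain ⟨v, hv, hJv⟩ := Ideal.exists_ne_zero_smul_eq_zero_of_mem_powTorsion (hJM v₀) hv₀
    have hsmul : ∀ r : R, ∃ c : K, r • v = c • v := fun r ↦ by
      obtain ⟨c, hc⟩ := hJ r
      refine ⟨c, ?_⟩
      have := hJv _ hc
      rwa [sub_smul, algebraMap_smul, sub_eq_zero] at this
    -- Since `J` kills `v` and R = K + J, the submodule R·v is the line K·v. It is simple, and the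
    -- induction passes to the quotient by it.
    let N : Submodule R M := R ∙ v
    have hvN : v ∈ N := Submodule.mem_span_singleton_self v
    have hN : ∀ x : N, ∃ c : K, c • (⟨v, hvN⟩ : N) = x := by
      rintro ⟨x, hx⟩
      obtain ⟨r, rfl⟩ := Submodule.mem_span_singleton.1 hx
      obtain ⟨c, hc⟩ := hsmul r
      exact ⟨c, Subtype.ext hc.symm⟩
    have hv' : (⟨v, hvN⟩ : N) ≠ 0 := fun h ↦ hv (congrArg Subtype.val h)
    have hN1 : Module.finrank K N = 1 := (finrank_eq_one_iff_of_nonzero' _ hv').2 hN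
    have hsimple : IsSimpleModule R N := by
      rw [isSimpleModule_iff_toSpanSingleton_surjective]
      refine ⟨⟨_, _, hv'⟩, fun x hx y ↦ ?_⟩
      obtain ⟨c, rfl⟩ := hN x
      obtain ⟨e, rfl⟩ := hN y
      have hc : c ≠ 0 := by rintro rfl; exact hx (zero_smul _ _)
      refine ⟨algebraMap K R (e * c⁻¹), ?_⟩
      rw [LinearMap.toSpanSingleton_apply, algebraMap_smul, smul_smul, mul_assoc,
        inv_mul_cancel₀ hc, mul_one]
    have hQ : Module.finrank K (M ⧸ N) = n := by
      have h1 := LinearMap.finrank_range_add_finrank_ker (N.mkQ.restrictScalars K)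
      have h2 : LinearMap.range (N.mkQ.restrictScalars K) = ⊤ :=
        LinearMap.range_eq_top.2 N.mkQ_surjective
      have h3 : LinearMap.ker (N.mkQ.restrictScalars K) = N.restrictScalars K := by
        ext x
        simp
      rw [h2, h3, finrank_top] at h1
      have h4 : Module.finrank K (N.restrictScalars K) = 1 := hN1
      omega
    have hfin : Module.Finite K (M ⧸ N) :=
      Module.Finite.of_surjective (N.mkQ.restrictScalars K) N.mkQ_surjective
    rw [Module.length_eq_add_of_exact N.subtype N.mkQ N.injective_subtype N.mkQ_surjective
      (LinearMap.exact_subtype_mkQ N), Module.length_eq_one, ih (M ⧸ N) (fun x ↦ by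
        obtain ⟨x, rfl⟩ := N.mkQ_surjective x
        obtain ⟨m, hm⟩ := hJM x
        exact ⟨m, fun r hr ↦ by rw [← map_smul, hm r hr, map_zero]⟩) hQ]
    push_cast
    rw [add_comm]

/-! ### Dimension and length of H¹ under the degree condition -/

namespace MonomialCurve
open AddMonoidAlgebra
variable {k : ℕ} {a : Fin (k + 1) → ℕ} {K : Type u} [Field K]

lemma exists_sub_algebraMap_mem_maxIdeal (r : KS a K) :
    ∃ c : K, r - algebraMap K (KS a K) c ∈ maxIdeal a K := by
  induction r using AddMonoidAlgebra.induction_linear with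
  | zero => exact ⟨0, by simp⟩
  | add f g hf hg =>
    obtain ⟨c, hc⟩ := hf
    obtain ⟨e, he⟩ := hg
    refine ⟨c + e, ?_⟩
    rw [map_add, add_sub_add_comm]
    exact add_mem hc he
  | single s c =>
    rcases eq_or_ne s 0 with rfl | hs
    · exact ⟨c, by simp⟩
    · refine ⟨0, ?_⟩
      have : (single s c : KS a K) = single 0 c * single s 1 := by simp [single_mul_single]
      rw [map_zero, sub_zero, this]
      exact Ideal.mul_mem_left _ _ (Ideal.subset_span ⟨s, hs, rfl⟩)

variable (a K) in
/-- Evaluation of the coefficients at the points `w_i`, `i ∈ 𝕀`. -/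
def coeffW : AddMonoidAlgebra K (ℕ × ℕ) →ₗ[K] (II a → K) where
  toFun f i := f.coeff (w a i)
  map_add' _ _ := rfl
  map_smul' _ _ := rfl

namespace Admissible
variable (h : Admissible a)
include h

lemma coeffW_incl (f : KS a K) : coeffW a K (incl a K f) = 0 := by
  funext i
  by_contra hne
  exact (h.mem_II_iff.1 i.2).2
    (mem_range_incl_iff.1 (LinearMap.mem_range_self (incl a K) f) _ (Finsupp.mem_support_iff.2 hne))

variable (K) in
/-- Under the degree condition, the torsion of `K[ℕ²]/K[S]` has the monomials with exponents
`w_i`, `i ∈ 𝕀`, as a basis. -/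
lemma nonempty_powTorsion_equiv (hc : ∀ i ∈ II a, degreeCondition a i) :
    Nonempty ((maxIdeal a K).powTorsion (AddMonoidAlgebra K (ℕ × ℕ) ⧸ LinearMap.range (incl a K))
      ≃ₗ[K] (II a → K)) := by
  let N := LinearMap.range (incl a K)
  let Ψ : (AddMonoidAlgebra K (ℕ × ℕ) ⧸ N) →ₗ[K] (II a → K) :=
    (N.restrictScalars K).liftQ (coeffW a K) (by
      rintro _ ⟨f, rfl⟩
      exact h.coeffW_incl f) ∘ₗ (Submodule.Quotient.restrictScalarsEquiv K N).symm.toLinearMap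
  have hΨ : ∀ f, Ψ (N.mkQ f) = coeffW a K f := fun f ↦ rfl
  let Φ := Ψ ∘ₗ ((maxIdeal a K).powTorsion (AddMonoidAlgebra K (ℕ × ℕ) ⧸ N)).subtype.restrictScalars K
  refine ⟨LinearEquiv.ofBijective Φ ⟨?_, ?_⟩⟩
  · rw [injective_iff_map_eq_zero]
    rintro ⟨y, hy⟩ h0
    obtain ⟨f, rfl⟩ := N.mkQ_surjective y
    have h1 : coeffW a K f = 0 := h0
    rw [h.mk_mem_powTorsion_iff] at hy
    ext1
    change N.mkQ f = 0
    rw [← LinearMap.mem_ker, Submodule.ker_mkQ, mem_range_incl_iff]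
    intro u hu
    by_contra hS
    obtain ⟨i, hi, rfl⟩ := (h.mem_saturation_diff_iff hc u).1 ⟨hy u hu, hS⟩
    exact Finsupp.mem_support_iff.1 hu (congrFun h1 ⟨i, hi⟩)
  · intro g
    let f : AddMonoidAlgebra K (ℕ × ℕ) := ∑ i : II a, single (w a i) (g i)
    have hf : ∀ u, f.coeff u = ∑ i : II a, if w a i = u then g i else 0 := fun u ↦ by
      simp [f, coeff_sum, Finsupp.finsetSum_apply, Finsupp.single_apply]
    have hmem : N.mkQ f ∈ (maxIdeal a K).powTorsion _ := by
      rw [h.mk_mem_powTorsion_iff]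
      intro u hu
      rw [Finsupp.mem_support_iff, hf] at hu
      obtain ⟨i, -, hi⟩ := Finset.exists_ne_zero_of_sum_ne_zero hu
      obtain rfl : w a i = u := by
        by_contra hne
        exact hi (if_neg hne)
      exact h.w_mem_saturation (h.mem_II_iff.1 i.2).1.le
    refine ⟨⟨_, hmem⟩, ?_⟩
    change coeffW a K f = g
    funext j
    change f.coeff (w a j) = g j
    rw [hf, Finset.sum_eq_single j]
    · simp
    · intro i _ hij
      exact if_neg fun hw ↦ hij (Subtype.ext (h.w_injOn i.2 j.2 hw))
    · simp

variable (K) in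
lemma nonempty_H1K_equiv (hc : ∀ i ∈ II a, degreeCondition a i) :
    Nonempty (H1K a K ≃ₗ[K] ⨁ i : II a, line K (w a i)) := by
  obtain ⟨φ⟩ := h.nonempty_H1_equiv K
  obtain ⟨ψ⟩ := h.nonempty_powTorsion_equiv K hc
  let φ' : H1K a K ≃ₗ[K] (maxIdeal a K).powTorsion
      (AddMonoidAlgebra K (ℕ × ℕ) ⧸ LinearMap.range (incl a K)) :=
    { φ.toAddEquiv with
      map_smul' := fun c x ↦ (φ.map_smul (algebraMap K (KS a K) c) x).trans
        (algebraMap_smul (KS a K) c (φ x)) }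
  let χ : (⨁ i : II a, line K (w a i)) ≃ₗ[K] (II a → K) :=
    DirectSum.linearEquivFunOnFintype K (II a) (fun i ↦ line K (w a i)) ≪≫ₗ
      LinearEquiv.piCongrRight fun i ↦
        (LinearEquiv.toSpanNonzeroSingleton K _ (single (w a i) (1 : K)) (by simp)).symm
  exact ⟨φ' ≪≫ₗ ψ ≪≫ₗ χ.symm⟩

variable (K) in
lemma length_H1 (hc : ∀ i ∈ II a, degreeCondition a i) :
    Module.length (KS a K) (H1 a K) = ((II a).card : ℕ∞) := by
  obtain ⟨φ⟩ := h.nonempty_H1_equiv K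
  obtain ⟨ψ⟩ := h.nonempty_powTorsion_equiv K hc
  rw [φ.length_eq]
  have : Module.Finite K ((maxIdeal a K).powTorsion
      (AddMonoidAlgebra K (ℕ × ℕ) ⧸ LinearMap.range (incl a K))) := Module.Finite.equiv ψ.symm
  refine Module.length_eq_finrank_of_powTorsion (K := K) exists_sub_algebraMap_mem_maxIdeal _ _
    ?_ ?_
  · rintro ⟨v, n, hn⟩
    exact ⟨n, fun r hr ↦ Subtype.ext (hn r hr)⟩
  · rw [ψ.finrank_eq, Module.finrank_fintype_fun_eq_card, Fintype.card_coe]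

end Admissible
end MonomialCurve

/-! ### Cohen–Macaulay implies that 𝕀 is empty -/

namespace MonomialCurve
open AddMonoidAlgebra
variable {k : ℕ} {a : Fin (k + 1) → ℕ} {K : Type u} [Field K]

variable (a K) in
/-- The projection of `K[S]` onto the face spanned by the second coordinate axis. -/
def faceMap : KS a K →ₐ[K] Polynomial K :=
  AddMonoidAlgebra.lift K (Polynomial K) (S a)
    { toFun := fun s ↦ if s.toAdd.1.1 = 0 then Polynomial.X ^ s.toAdd.1.2 else 0
      map_one' := by simp
      map_mul' := fun s t ↦ by
        simp only [toAdd_mul, AddSubmonoid.coe_add, Prod.fst_add, Prod.snd_add, Nat.add_eq_zero_iff]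
        by_cases hs : s.toAdd.1.1 = 0 <;> by_cases ht : t.toAdd.1.1 = 0 <;> simp [hs, ht, pow_add] }

lemma faceMap_single (s : S a) : faceMap a K (single s 1) =
    if s.1.1 = 0 then Polynomial.X ^ s.1.2 else 0 := by
  rw [faceMap, AddMonoidAlgebra.lift_single, one_smul]
  rfl

variable (a K) in
/-- The augmentation `K[S] → K`. -/
def augmentation : KS a K →ₐ[K] K := (Polynomial.aeval (0 : K)).comp (faceMap a K)

instance : (RingHom.ker (augmentation a K)).IsMaximal :=
  RingHom.ker_isMaximal_of_surjective _ fun c ↦ ⟨algebraMap K _ c, (augmentation a K).commutes c⟩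

lemma augmentation_single {s : S a} (hs : s ≠ 0) : augmentation a K (single s 1) = 0 := by
  rw [augmentation, AlgHom.comp_apply, faceMap_single]
  split_ifs with h1
  · have : s.1.2 ≠ 0 := fun h2 ↦ hs (Subtype.ext (Prod.ext h1 h2))
    simp [this]
  · simp

lemma ker_augmentation : RingHom.ker (augmentation a K) = maxIdeal a K := by
  have hle : maxIdeal a K ≤ RingHom.ker (augmentation a K) := by
    refine Ideal.span_le.2 ?_
    rintro _ ⟨s, hs, rfl⟩
    exact augmentation_single hs
  refine le_antisymm (fun r hr ↦ ?_) hle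
  obtain ⟨c, hc⟩ := exists_sub_algebraMap_mem_maxIdeal r
  have := hle hc
  rw [RingHom.mem_ker] at this hr
  rw [map_sub, hr, zero_sub, neg_eq_zero, AlgHom.commutes] at this
  have hc0 : c = 0 := this
  simpa [hc0] using hc

instance : (maxIdeal a K).IsMaximal := ker_augmentation (a := a) (K := K) ▸ inferInstance

namespace Admissible
variable (h : Admissible a)
include h

variable (K) in
-- The kernel of the face map is a prime strictly between 0 and 𝔪: it contains t^{(d,0)} but not
-- t^{(0,d)}.
lemma two_le_height : 2 ≤ (maxIdeal a K).height := by
  have hd := h.d_pos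
  have : (RingHom.ker (faceMap a K)).IsPrime := RingHom.ker_isPrime _
  have h1 : (⊥ : Ideal (KS a K)) < RingHom.ker (faceMap a K) := by
    rw [bot_lt_iff_ne_bot]
    intro h0
    have : mono K (a := a) d_zero_mem_S ∈ RingHom.ker (faceMap a K) := by
      rw [RingHom.mem_ker, mono, faceMap_single, if_neg hd.ne']
    rw [h0, Ideal.mem_bot, mono] at this
    simp at this
  have h2 : RingHom.ker (faceMap a K) < maxIdeal a K := by
    rw [← ker_augmentation]
    refine lt_of_le_of_ne (fun r hr ↦ ?_) fun heq ↦ ?_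
    · rw [RingHom.mem_ker] at hr ⊢
      rw [augmentation, AlgHom.comp_apply, hr, map_zero]
    · have : mono K (a := a) h.zero_d_mem_S ∈ RingHom.ker (augmentation a K) :=
        augmentation_single fun h0 ↦ hd.ne' (congrArg (fun s : S a ↦ s.1.2) h0)
      rw [← heq, RingHom.mem_ker, mono, faceMap_single, if_pos rfl] at this
      exact pow_ne_zero _ Polynomial.X_ne_zero this
  have e1 := Ideal.height_add_one_le_of_lt_of_isPrime h1
  have e2 := Ideal.height_add_one_le_of_lt_of_isPrime h2
  calc (2 : ℕ∞) = 0 + 1 + 1 := rfl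
    _ ≤ _ := add_le_add_left (add_le_add_left bot_le 1) 1
    _ ≤ _ := add_le_add_left e1 1
    _ ≤ _ := e2

/-- If `𝕀` is non-empty, some element of `K[ℕ²]` outside `K[S]` is multiplied into `K[S]` by the
maximal homogeneous ideal. -/
lemma exists_socle (hI : II a ≠ ∅) : ∃ f ∉ LinearMap.range (incl a K),
    ∀ r ∈ maxIdeal a K, r • f ∈ LinearMap.range (incl a K) := by
  obtain ⟨i, hi⟩ := Finset.nonempty_iff_ne_empty.2 hI
  rw [h.mem_II_iff] at hi
  have h1 := (h.mk_mem_powTorsion_iff (K := K) (single (w a i) 1)).2 (by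
    simpa [Finsupp.support_single] using h.w_mem_saturation hi.1.le)
  have h2 : (LinearMap.range (incl a K)).mkQ (single (w a i) (1 : K)) ≠ 0 := by
    rw [Ne, ← LinearMap.mem_ker, Submodule.ker_mkQ, mem_range_incl_iff]
    exact fun hS ↦ hi.2 (hS _ (by simp))
  obtain ⟨v, hv, hm⟩ := Ideal.exists_ne_zero_smul_eq_zero_of_mem_powTorsion h1 h2
  obtain ⟨f, rfl⟩ := Submodule.mkQ_surjective _ v
  refine ⟨f, fun hf ↦ hv ?_, fun r hr ↦ ?_⟩
  · rwa [← LinearMap.mem_ker, Submodule.ker_mkQ]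
  · have := hm r hr
    rwa [← map_smul, ← LinearMap.mem_ker, Submodule.ker_mkQ] at this

/-- Height at least two gives a regular sequence starting r₁, r₂ at 𝔪. For a socle element f, both
r₁f and r₂f are in the localization, and r₂(r₁f) is divisible by r₁. Hence r₁ divides r₁f there, so
f itself lies in the localization, which forces f ∈ K[S]. -/
lemma II_eq_empty_of_isCohenMacaulayRing (hCM : IsCohenMacaulayRing (KS a K)) : II a = ∅ := by
  by_contra hI
  obtain ⟨f, hf, hmf⟩ := h.exists_socle (K := K) hI
  let m := maxIdeal a K
  let A := Localization.AtPrime m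
  obtain ⟨-, rs, hrs, hreg, hlen⟩ := hCM.2 m
  have hdim := IsLocalization.AtPrime.ringKrullDim_eq_height m A
  have h2 : 2 ≤ rs.length := by
    have h3 := hlen.trans hdim
    have h4 : ((rs.length : ℕ∞) : WithBot ℕ∞) = (m.height : WithBot ℕ∞) := h3
    rw [WithBot.coe_inj] at h4
    have := h.two_le_height K
    rw [← h4] at this
    exact_mod_cast this
  obtain ⟨r₁, r₂, t, rfl⟩ : ∃ r₁ r₂ t, rs = r₁ :: r₂ :: t := by
    match rs, h2 with
    | r₁ :: r₂ :: t, _ => exact ⟨r₁, r₂, t, rfl⟩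
  have hw := hreg.toIsWeaklyRegular
  rw [RingTheory.Sequence.isWeaklyRegular_cons_iff, RingTheory.Sequence.isWeaklyRegular_cons_iff] at hw
  obtain ⟨hr₁, hr₂, -⟩ := hw
  have hinj : Function.Injective (algebraMap (KS a K) A) :=
    IsLocalization.injective A (Ideal.primeCompl_le_nonZeroDivisors m)
  -- Denominators are cleared here: r₁ = ρ₁/σ₁ and r₂ = ρ₂/σ₂, with ρ₁, ρ₂ ∈ 𝔪.
  have hfrac : ∀ r ∈ IsLocalRing.maximalIdeal A, ∃ ρ ∈ m, ∃ σ ∉ m,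
      r * algebraMap (KS a K) A σ = algebraMap (KS a K) A ρ := fun r hr ↦ by
    obtain ⟨⟨ρ, σ⟩, hρ⟩ := IsLocalization.surj m.primeCompl r
    refine ⟨ρ, ?_, σ, σ.2, hρ⟩
    rw [← IsLocalization.AtPrime.to_map_mem_maximal_iff A m, ← hρ]
    exact Ideal.mul_mem_right _ _ hr
  obtain ⟨ρ₁, hρ₁, σ₁, hσ₁, e₁⟩ := hfrac r₁ (hrs r₁ (by simp))
  obtain ⟨ρ₂, hρ₂, σ₂, hσ₂, e₂⟩ := hfrac r₂ (hrs r₂ (by simp))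
  obtain ⟨c₁, hc₁⟩ := hmf ρ₁ hρ₁
  obtain ⟨c₂, hc₂⟩ := hmf ρ₂ hρ₂
  have hcomm : ρ₂ * c₁ = ρ₁ * c₂ := incl_injective a K (by
    rw [incl_mul, incl_mul, hc₁, hc₂, smul_eq_incl_mul, smul_eq_incl_mul]
    ring)
  have hcomm' := congrArg (algebraMap (KS a K) A) hcomm
  rw [map_mul, map_mul, ← e₁, ← e₂] at hcomm'
  obtain ⟨z, hz⟩ : ∃ z, r₁ * z = algebraMap (KS a K) A (σ₂ * c₁) := by
    have h5 : r₂ • (Submodule.Quotient.mk (algebraMap (KS a K) A (σ₂ * c₁)) : QuotSMulTop r₁ A) =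
        r₂ • 0 := by
      rw [smul_zero, ← Submodule.Quotient.mk_smul, Submodule.Quotient.mk_eq_zero,
        Submodule.mem_smul_pointwise_iff_exists]
      refine ⟨algebraMap (KS a K) A (σ₁ * c₂), trivial, ?_⟩
      rw [smul_eq_mul, smul_eq_mul, map_mul, map_mul]
      linear_combination -hcomm'
    have h6 := hr₂ h5
    rw [Submodule.Quotient.mk_eq_zero, Submodule.mem_smul_pointwise_iff_exists] at h6
    obtain ⟨z, -, hz⟩ := h6
    exact ⟨z, hz⟩
  obtain ⟨⟨p, q⟩, hpq⟩ := IsLocalization.surj m.primeCompl z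
  have hq : (q : KS a K) ∉ m := q.2
  have key : (q * σ₁ * σ₂) * c₁ = ρ₁ * p := hinj (by
    simp only [map_mul] at hz hpq ⊢
    rw [← e₁]
    linear_combination (-(algebraMap (KS a K) A q * algebraMap (KS a K) A σ₁)) * hz +
      r₁ * algebraMap (KS a K) A σ₁ * hpq)
  have hρ0 : ρ₁ ≠ 0 := by
    rintro rfl
    rw [map_zero, mul_eq_zero_iff_right] at e₁
    · subst e₁
      exact zero_ne_one (hr₁ (show (0 : A) • (0 : A) = (0 : A) • (1 : A) by simp))
    · intro h0
      rw [map_eq_zero_iff _ hinj] at h0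
      exact hσ₁ (h0 ▸ zero_mem _)
  set τ := q * σ₁ * σ₂ with hτ
  have hτm : τ ∉ m := fun hmem ↦ by
    have hp : m.IsPrime := inferInstance
    rcases hp.mem_or_mem hmem with h7 | h7
    · exact (hp.mem_or_mem h7).elim hq hσ₁
    · exact hσ₂ h7
  have hτf : τ • f = incl a K p := by
    have h8 : incl a K τ * (ρ₁ • f) = incl a K ρ₁ * incl a K p := by
      rw [← hc₁, ← incl_mul, key, incl_mul]
    rw [smul_eq_incl_mul] at h8
    have h9 : incl a K ρ₁ ≠ 0 := fun h0 ↦ hρ0 (incl_injective a K (h0.trans (map_zero _).symm))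
    apply mul_left_cancel₀ h9
    rw [smul_eq_incl_mul, ← h8]
    ring
  -- Modulo 𝔪 the element τ is a non-zero constant `c`. As τf and 𝔪f lie in K[S], so does cf.
  obtain ⟨c, hc⟩ := exists_sub_algebraMap_mem_maxIdeal τ
  have hc0 : c ≠ 0 := by
    rintro rfl
    exact hτm (by simpa using hc)
  have h10 := sub_mem (⟨p, hτf.symm⟩ : τ • f ∈ LinearMap.range (incl a K)) (hmf _ hc)
  rw [sub_smul, sub_sub_cancel, algebraMap_smul] at h10
  refine hf ?_
  have h11 := Submodule.smul_mem _ (algebraMap K (KS a K) c⁻¹) h10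
  rwa [algebraMap_smul, smul_smul, inv_mul_cancel₀ hc0, one_smul] at h11

end Admissible
end MonomialCurve

/-! ### Emptiness of 𝕀 implies Cohen–Macaulay -/

/-- Modulo `c` the polynomial `g` stays monic, hence a non-zero-divisor. -/
lemma Polynomial.C_dvd_of_dvd_monic_mul {R : Type*} [CommRing R] {c : R} {g r : Polynomial R}
    (hg : g.Monic) (hdvd : C c ∣ g * r) : C c ∣ r := by
  let π := Ideal.Quotient.mk (Ideal.span {c})
  have hπ : π c = 0 := Ideal.Quotient.eq_zero_iff_mem.2 (Ideal.mem_span_singleton_self c)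
  obtain ⟨s, hs⟩ := hdvd
  have h1 := congrArg (map π) hs
  rw [Polynomial.map_mul, Polynomial.map_mul, map_C, hπ, C_0, zero_mul,
    (hg.map π).mul_right_eq_zero_iff] at h1
  rw [C_dvd_iff_dvd_coeff]
  intro i
  have h2 := congrArg (coeff · i) h1
  simp only [coeff_map, coeff_zero] at h2
  exact Ideal.mem_span_singleton.1 (Ideal.Quotient.eq_zero_iff_mem.1 h2)

namespace MonomialCurve
open AddMonoidAlgebra

/-- `K[ℕ²]` as a ring of polynomials in the first variable. -/
def planeEquiv (K : Type u) [Field K] :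
    AddMonoidAlgebra K (ℕ × ℕ) ≃+* Polynomial (AddMonoidAlgebra K ℕ) :=
  (curryAlgEquiv (A := K) (M := ℕ) (N := ℕ) K).toRingEquiv.trans
    (Polynomial.toFinsuppIso (AddMonoidAlgebra K ℕ)).symm

lemma planeEquiv_single {K : Type u} [Field K] (m n : ℕ) (r : K) :
    planeEquiv K (single (m, n) r) = Polynomial.monomial m (single n r) := by
  rw [← Polynomial.ofFinsupp_single, ← curryAlgEquiv_single (R := K)]
  rfl

/-- Over the ring of polynomials in the second variable, f(t^{(0,d)}) is a constant and g(t^{(d,0)})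
is monic. -/
lemma dvd_of_aeval_dvd_aeval_mul {K : Type u} [Field K] {d : ℕ} (hd : 0 < d)
    {f g : Polynomial K} (hg : g.Monic) {r : AddMonoidAlgebra K (ℕ × ℕ)}
    (hdvd : Polynomial.aeval (single (0, d) (1 : K) : AddMonoidAlgebra K (ℕ × ℕ)) f ∣
      Polynomial.aeval (single (d, 0) (1 : K) : AddMonoidAlgebra K (ℕ × ℕ)) g * r) :
    Polynomial.aeval (single (0, d) (1 : K) : AddMonoidAlgebra K (ℕ × ℕ)) f ∣ r := by
  let Ψ : AddMonoidAlgebra K (ℕ × ℕ) →+* Polynomial (AddMonoidAlgebra K ℕ) := planeEquiv K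
  have hC : Ψ.comp (algebraMap K _) = Polynomial.C.comp (algebraMap K (AddMonoidAlgebra K ℕ)) := by
    ext1 c
    exact planeEquiv_single 0 0 c
  have hf : Ψ (Polynomial.aeval (single (0, d) (1 : K)) f) =
      Polynomial.C (Polynomial.aeval (single d (1 : K)) f) := by
    rw [Polynomial.aeval_def, Polynomial.aeval_def, Polynomial.hom_eval₂, Polynomial.hom_eval₂, hC]
    congr 1
    exact planeEquiv_single 0 d 1
  have hg' : Ψ (Polynomial.aeval (single (d, 0) (1 : K)) g) =
      Polynomial.expand _ d (g.map (algebraMap K (AddMonoidAlgebra K ℕ))) := by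
    rw [Polynomial.aeval_def, Polynomial.hom_eval₂, hC, Polynomial.expand_eq_comp_X_pow,
      Polynomial.comp, Polynomial.eval₂_map]
    congr 1
    refine (planeEquiv_single d 0 1).trans ?_
    rw [← Polynomial.monomial_one_right_eq_X_pow]
    rfl
  have h1 := map_dvd Ψ hdvd
  rw [map_mul, hf, hg'] at h1
  have h2 := Polynomial.C_dvd_of_dvd_monic_mul ((hg.map _).expand hd) h1
  rw [← hf] at h2
  exact (map_dvd_iff (planeEquiv K)).1 h2

variable {k : ℕ} {a : Fin (k + 1) → ℕ} {K : Type u} [Field K]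

lemma incl_aeval (f : Polynomial K) (r : KS a K) :
    incl a K (Polynomial.aeval r f) = Polynomial.aeval (incl a K r) f :=
  (Polynomial.aeval_algHom_apply (toPlane a K) r f).symm

/-- Among the exponents of `q` that no multiple of `v` moves into S, take `u` of largest coordinate
sum. The leading term of `f` contributes u + (deg f)·v to the product. A lower term could reach it
only from some u + jv with j > 0, another such exponent of larger sum, so nothing cancels. -/
lemma exists_add_nsmul_mem_S {v : ℕ × ℕ} (hv : v ∈ S a) (hv0 : v ≠ 0) {f : Polynomial K}
    (hf : f.Monic) {q : AddMonoidAlgebra K (ℕ × ℕ)}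
    (hq : Polynomial.aeval (mono K hv) f • q ∈ LinearMap.range (incl a K)) :
    ∀ u ∈ q.coeff.support, ∃ n : ℕ, u + n • v ∈ S a := by
  classical
  by_contra! hne
  let T := q.coeff.support.filter fun u ↦ ∀ n : ℕ, u + n • v ∉ S a
  have hT : T.Nonempty := by
    obtain ⟨u, hu, hu'⟩ := hne
    exact ⟨u, Finset.mem_filter.2 ⟨hu, hu'⟩⟩
  obtain ⟨u, hu, hmax⟩ := T.exists_max_image (fun u ↦ u.1 + u.2) hT
  obtain ⟨hu1, hu2⟩ := Finset.mem_filter.1 hu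
  refine hu2 f.natDegree (mem_range_incl_iff.1 hq _ ?_)
  have hterm : ∀ i ∈ Finset.range (f.natDegree + 1),
      ((f.coeff i • mono K hv ^ i) • q).coeff (u + f.natDegree • v) =
        if i = f.natDegree then q.coeff u else 0 := by
    intro i hi
    obtain ⟨j, hj⟩ := Nat.exists_eq_add_of_le (Nat.lt_succ_iff.1 (Finset.mem_range.1 hi))
    rw [hj, add_smul, add_left_comm, smul_assoc, coeff_smul, mono_pow, mono, Finsupp.smul_apply]
    have key := single_smul_apply_add (K := K) (s := ⟨_, nsmul_mem hv i⟩) q (u + j • v)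
    dsimp only at key
    rw [key]
    rcases Nat.eq_zero_or_pos j with rfl | hj0
    · rw [add_zero] at hj ⊢
      rw [if_pos rfl, ← hj, hf.coeff_natDegree, zero_smul, add_zero, one_smul]
    · rw [if_neg (by omega)]
      have : q.coeff (u + j • v) = 0 := by
        by_contra hc
        have h1 := hmax (u + j • v) (Finset.mem_filter.2 ⟨Finsupp.mem_support_iff.2 hc, fun n ↦ by
          rw [add_assoc, ← add_smul]
          exact hu2 _⟩)
        simp only [Prod.fst_add, Prod.snd_add, Prod.smul_fst, Prod.smul_snd, smul_eq_mul] at h1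
        refine hv0 (Prod.ext ?_ ?_)
        · change v.1 = 0
          nlinarith
        · change v.2 = 0
          nlinarith
      rw [this, smul_zero]
  rw [Finsupp.mem_support_iff, Polynomial.aeval_eq_sum_range, Finset.sum_smul, coeff_sum,
    Finsupp.finsetSum_apply, Finset.sum_congr rfl hterm, Finset.sum_ite_eq' (Finset.range _),
    if_pos (Finset.mem_range.2 (Nat.lt_succ_self _))]
  exact Finsupp.mem_support_iff.1 hu1

namespace Admissible
variable (h : Admissible a)
include h

/-- If yr = xs in K[S], then r = xq for some q in K[ℕ²], and s = yq. So xq and yq lie in K[S], the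
exponents of q lie in the saturation, which is S, and q ∈ K[S]. -/
lemma isWeaklyRegular_aeval (hI : II a = ∅) {f g : Polynomial K} (hf : f.Monic) (hg : g.Monic) :
    RingTheory.Sequence.IsWeaklyRegular (KS a K)
      [Polynomial.aeval (mono K h.zero_d_mem_S) f,
        Polynomial.aeval (mono K (a := a) d_zero_mem_S) g] := by
  have hd := h.d_pos
  set x := Polynomial.aeval (mono K h.zero_d_mem_S) f with hx
  set y := Polynomial.aeval (mono K (a := a) d_zero_mem_S) g with hy
  have hx0 : x ≠ 0 := by
    intro h0
    have h1 := congrArg (faceMap a K) h0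
    rw [hx, ← Polynomial.aeval_algHom_apply, mono, faceMap_single, if_pos rfl, map_zero,
      ← Polynomial.expand_aeval, Polynomial.aeval_X_left_apply] at h1
    exact (hf.expand hd).ne_zero h1
  rw [RingTheory.Sequence.isWeaklyRegular_cons_iff,
    RingTheory.Sequence.isWeaklyRegular_singleton_iff]
  refine ⟨fun r s hrs ↦ mul_left_cancel₀ hx0 hrs, ?_⟩
  rw [isSMulRegular_iff_right_eq_zero_of_smul]
  intro r hr
  obtain ⟨r, rfl⟩ := Submodule.Quotient.mk_surjective _ r
  rw [← Submodule.Quotient.mk_smul, Submodule.Quotient.mk_eq_zero,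
    Submodule.mem_smul_pointwise_iff_exists] at hr
  obtain ⟨s, -, hs⟩ := hr
  rw [smul_eq_mul, smul_eq_mul] at hs
  have hix : incl a K x = Polynomial.aeval (single (0, d a) (1 : K)) f := by
    rw [hx, incl_aeval, mono, incl_single]
  have hiy : incl a K y = Polynomial.aeval (single (d a, 0) (1 : K)) g := by
    rw [hy, incl_aeval, mono, incl_single]
  have h1 : incl a K x * incl a K s = incl a K y * incl a K r := by
    rw [← incl_mul, ← incl_mul, hs]
  obtain ⟨q, hq⟩ : incl a K x ∣ incl a K r := by
    rw [hix]
    exact dvd_of_aeval_dvd_aeval_mul hd hg ⟨incl a K s, by rw [← hix, ← hiy, h1]⟩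
  have hxi : incl a K x ≠ 0 := fun h0 ↦ hx0 (incl_injective a K (h0.trans (map_zero _).symm))
  have hq1 : x • q ∈ LinearMap.range (incl a K) := ⟨r, hq⟩
  have hq2 : y • q ∈ LinearMap.range (incl a K) := ⟨s, mul_left_cancel₀ hxi (by
    rw [h1, hq, smul_eq_incl_mul]
    ring)⟩
  have hqS : q ∈ LinearMap.range (incl a K) := by
    rw [mem_range_incl_iff]
    intro u hu
    obtain ⟨n, hn⟩ := exists_add_nsmul_mem_S _ (by simp [hd.ne']) hf hq1 u hu
    obtain ⟨m, hm⟩ := exists_add_nsmul_mem_S _ (by simp [hd.ne']) hg hq2 u hu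
    refine h.II_eq_empty_iff.1 hI u ⟨n + m, ?_, ?_⟩
    · rw [add_smul, ← add_assoc]
      exact add_mem hn (nsmul_mem h.zero_d_mem_S m)
    · rw [add_comm n, add_smul, ← add_assoc]
      exact add_mem hm (nsmul_mem d_zero_mem_S n)
  obtain ⟨p, rfl⟩ := hqS
  rw [Submodule.Quotient.mk_eq_zero, Submodule.mem_smul_pointwise_iff_exists]
  exact ⟨p, trivial, incl_injective a K (by rw [smul_eq_mul, incl_mul, hq])⟩

/-- The axis monomials become integral over K in the quotient, and the d-th power of every
generating monomial is a product of powers of them. -/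
lemma isIntegral_of_aeval_mem {f g : Polynomial K} (hf : f.Monic) (hg : g.Monic)
    {P : Ideal (KS a K)}
    (hfP : Polynomial.aeval (mono K h.zero_d_mem_S) f ∈ P)
    (hgP : Polynomial.aeval (mono K (a := a) d_zero_mem_S) g ∈ P) :
    Algebra.IsIntegral K (KS a K ⧸ P) := by
  let π := Ideal.Quotient.mkₐ K P
  have hx : IsIntegral K (π (mono K h.zero_d_mem_S)) := ⟨f, hf, by
    rw [← Polynomial.aeval_def, Polynomial.aeval_algHom_apply]
    exact Ideal.Quotient.eq_zero_iff_mem.2 hfP⟩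
  have hy : IsIntegral K (π (mono K (a := a) d_zero_mem_S)) := ⟨g, hg, by
    rw [← Polynomial.aeval_def, Polynomial.aeval_algHom_apply]
    exact Ideal.Quotient.eq_zero_iff_mem.2 hgP⟩
  have key : ∀ s (hs : s ∈ S a), IsIntegral K (π (mono K hs)) := by
    intro s hs
    have hs' := hs
    rw [S] at hs'
    induction hs' using AddSubmonoid.closure_induction_left with
    | zero =>
      rw [show mono K hs = 1 from rfl, map_one]
      exact isIntegral_one
    | add_left v hv u hu ih =>
      have hvS : v ∈ S a := AddSubmonoid.subset_closure hv
      rw [← mono_mul hvS hu, map_mul]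
      refine .mul ?_ (ih hu)
      obtain ⟨j, rfl⟩ := hv
      refine .of_pow h.d_pos ?_
      rw [← map_pow, h.pow_mono_e j hvS, map_mul, map_pow, map_pow]
      exact (hy.pow _).mul (hx.pow _)
  refine ⟨fun r ↦ ?_⟩
  obtain ⟨r, rfl⟩ := Ideal.Quotient.mk_surjective r
  change IsIntegral K (π r)
  induction r using AddMonoidAlgebra.induction_linear with
  | zero => rw [map_zero]; exact isIntegral_zero
  | add f g hf hg => rw [map_add]; exact hf.add hg
  | single s c =>
    have : (single s c : KS a K) = c • mono K s.2 := by
      rw [mono, smul_single, smul_eq_mul, mul_one]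
    rw [this, map_smul]
    exact (key _ s.2).smul c

/-- A maximal ideal `n` need not contain the axis monomials, but by the Nullstellensatz its residue
field is finite over K, so it contains a monic polynomial in each. These two elements form the
regular sequence. -/
lemma isCohenMacaulayRing_of_II_eq_empty (hI : II a = ∅) : IsCohenMacaulayRing (KS a K) := by
  refine ⟨inferInstance, fun n hn ↦ ?_⟩
  have hfin : Algebra.IsIntegral K (KS a K ⧸ n) := by
    let := Ideal.Quotient.field n
    have : Module.Finite K (KS a K ⧸ n) := finite_of_finite_type_of_isJacobsonRing K _
    infer_instance
  have hex : ∀ r : KS a K, ∃ f : Polynomial K, f.Monic ∧ Polynomial.aeval r f ∈ n := by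
    intro r
    obtain ⟨f, hf, h0⟩ := hfin.isIntegral (Ideal.Quotient.mkₐ K n r)
    refine ⟨f, hf, Ideal.Quotient.eq_zero_iff_mem.1 ?_⟩
    rwa [← Polynomial.aeval_def, Polynomial.aeval_algHom_apply] at h0
  obtain ⟨f, hf, hfn⟩ := hex (mono K h.zero_d_mem_S)
  obtain ⟨g, hg, hgn⟩ := hex (mono K d_zero_mem_S)
  have hreg := h.isWeaklyRegular_aeval hI hf hg
  set x := Polynomial.aeval (mono K h.zero_d_mem_S) f
  set y := Polynomial.aeval (mono K (a := a) d_zero_mem_S) g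
  let A := Localization.AtPrime n
  have hmem : ∀ r ∈ [x, y], r ∈ n := by simp [hfn, hgn]
  have hreg' := hreg.isRegular_of_isLocalization_of_mem A n hmem
  refine ⟨IsLocalization.isNoetherianRing n.primeCompl A inferInstance,
    [x, y].map (algebraMap _ A), ?_, hreg', ?_⟩
  · intro r hr
    obtain ⟨s, hs, rfl⟩ := List.mem_map.1 hr
    exact (IsLocalization.AtPrime.to_map_mem_maximal_iff A n s).2 (hmem s hs)
  have hN : IsNoetherianRing A := IsLocalization.isNoetherianRing n.primeCompl A inferInstance
  -- Any prime containing `x` and `y` has a quotient integral over K, hence is maximal. So `n` is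
  -- minimal over (x, y), and Krull's height theorem bounds its height by 2.
  have hmin : n ∈ (Ideal.span {x, y}).minimalPrimes := by
    refine ⟨⟨inferInstance, Ideal.span_le.2 (by simp [Set.insert_subset_iff, hfn, hgn])⟩, ?_⟩
    rintro P ⟨hP, hxy⟩ hPn
    have := h.isIntegral_of_aeval_mem hf hg (hxy (Ideal.subset_span (.inl rfl)))
      (hxy (Ideal.subset_span (.inr rfl)))
    have hPm : P.IsMaximal := Ideal.Quotient.maximal_of_isField _
      (isField_of_isIntegral_of_isField' (Field.toIsField K))
    exact (hPm.eq_of_le hn.ne_top hPn).ge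
  apply le_antisymm
  · rw [← ringKrullDim_add_length_eq_ringKrullDim_of_isRegular _ hreg']
    have : Nontrivial (A ⧸ Ideal.ofList ([x, y].map (algebraMap (KS a K) A))) := by
      rw [Ideal.Quotient.nontrivial_iff]
      exact fun h0 ↦ hreg'.top_ne_smul (by rw [h0, Submodule.top_smul])
    exact le_add_of_nonneg_left ringKrullDim_nonneg_of_nontrivial
  · rw [IsLocalization.AtPrime.ringKrullDim_eq_height n A]
    have h1 := Ideal.height_le_card_of_mem_minimalPrimes_span (Set.toFinite _) hmin
    have h2 : (n.height : WithBot ℕ∞) ≤ ((2 : ℕ) : ℕ∞) := by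
      refine WithBot.coe_le_coe.2 (h1.trans ?_)
      exact_mod_cast Set.ncard_insert_le x {y} |>.trans (by simp)
    exact h2

end Admissible
end MonomialCurve

end

theorem theorem3p6 (K : Type u) [Field K] (k : ℕ) (hk : 3 ≤ k) (a : Fin (k + 1) → ℕ)
    (ha0 : a 0 = 0) (hmono : StrictMono a) (hgcd : Finset.univ.gcd a = 1) :
    (IsCohenMacaulayRing (MonomialCurve.KS a K) ↔ MonomialCurve.II a = ∅) ∧
    ((∀ i ∈ MonomialCurve.II a, MonomialCurve.degreeCondition a i) →
      Nonempty (MonomialCurve.H1K a K ≃ₗ[K]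
        ⨁ i : MonomialCurve.II a, MonomialCurve.line K (MonomialCurve.w a i)) ∧
      Module.length (MonomialCurve.KS a K) (MonomialCurve.H1 a K) =
        ((MonomialCurve.II a).card : ℕ∞) ∧
      (MonomialCurve.II a).card ≤ MonomialCurve.d a - k) ∧
    ((¬ IsCohenMacaulayRing (MonomialCurve.KS a K) ∧ MonomialCurve.IsBuchsbaum a K) ↔
      (MonomialCurve.II a ≠ ∅ ∧
        (∀ i ∈ MonomialCurve.II a, MonomialCurve.degreeCondition a i) ∧
        ¬ ∃ i ∈ MonomialCurve.II a, ∃ j ∈ MonomialCurve.II a, ∃ h ∈ MonomialCurve.inner a,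
          MonomialCurve.w a j = MonomialCurve.w a i + MonomialCurve.e a h)) := by
  have h : MonomialCurve.Admissible a := ⟨by omega, ha0, hmono, hgcd⟩
  have hCM : IsCohenMacaulayRing (MonomialCurve.KS a K) ↔ MonomialCurve.II a = ∅ :=
    ⟨h.II_eq_empty_of_isCohenMacaulayRing, h.isCohenMacaulayRing_of_II_eq_empty⟩
  refine ⟨hCM, fun hc ↦ ⟨h.nonempty_H1K_equiv K hc, h.length_H1 K hc, h.card_II_le⟩, ?_⟩
  rw [h.isBuchsbaum_iff, h.forall_add_mem_S_iff, hCM]
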